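/- Let $k$ be a non-negative integer with $k\le 3$. A $k$-CNF on $n$ variables is a conjunction of finitely many clauses, each of which is a disjunction of at most $k$ literals over the variables $x_0,\dots,x_{n-1}$ (the empty formula is true, the empty clause is false, and not every variable has to occur). GtMajority-$k$SAT is the following decision problem: given a $k$-CNF $F$ on $n$ variables (as a string that lists $n$ and the clauses of $F$, with numbers in binary), does $F$ have more than $2^{n-1}$ satisfying assignments among the $2^n$ assignments to its variables? Then GtMajority-$k$SAT is in $\mathsf{P}$, that is, the language of the encodings of its yes-instances is decided by a deterministic Turing machine in time polynomial in the length of the input. -/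

import Mathlib

open Computability Turing

/-- A literal over the `n` Boolean variables indexed by `Fin n`: a variable (`positive = true`) or
the negation of a variable (`positive = false`). -/
structure Literal (n : ℕ) where
  var : Fin n
  positive : Bool

/-- A clause, the disjunction of a finite list of literals. Its width is the length of the list. -/
abbrev Clause (n : ℕ) := List (Literal n)

/-- A CNF formula on `n` variables, the conjunction of a finite list of clauses. Not every
variable has to occur. -/
abbrev CNF (n : ℕ) := List (Clause n)

/-- The truth value of a literal under an assignment. -/
def Literal.eval {n : ℕ} (l : Literal n) (a : Fin n → Bool) : Bool :=
  if l.positive then a l.var else !(a l.var)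

/-- The truth value of a clause; the empty clause is false. -/
def Clause.eval {n : ℕ} (C : Clause n) (a : Fin n → Bool) : Bool :=
  C.any fun l => l.eval a

/-- The truth value of a CNF formula; the empty formula is true. -/
def CNF.eval {n : ℕ} (F : CNF n) (a : Fin n → Bool) : Bool :=
  F.all fun C => Clause.eval C a

/-- `#SAT(F)`: the number of satisfying assignments of `F` among all `2 ^ n` assignments. -/
def CNF.numSat {n : ℕ} (F : CNF n) : ℕ :=
  (Finset.univ.filter fun a : Fin n → Bool => CNF.eval F a = true).card

/-- `F` is a `k`-CNF: every clause has width at most `k`. -/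
def CNF.IsKCNF {n : ℕ} (k : ℕ) (F : CNF n) : Prop :=
  ∀ C ∈ F, C.length ≤ k

/-- A natural number in binary (least significant bit first, no superfluous zeros), as a string
over the alphabet `Γ'`, which has the symbols `bit b`, `bra`, `ket`, `comma` and `blank`. -/
def binary (m : ℕ) : List Γ' :=
  (encodeNat m).map Γ'.bit

/-- A literal is written as a comma, the sign bit, and the index of the variable in binary. -/
def Literal.encode {n : ℕ} (l : Literal n) : List Γ' :=
  Γ'.comma :: Γ'.bit l.positive :: binary l.var

/-- A clause is written as the sequence of its literals, between brackets. -/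
def Clause.encode {n : ℕ} (C : Clause n) : List Γ' :=
  Γ'.bra :: (C.flatMap Literal.encode ++ [Γ'.ket])

/-- A CNF formula on `n` variables is written as `n` in binary, followed by its clauses. -/
def CNF.encode {n : ℕ} (F : CNF n) : List Γ' :=
  binary n ++ F.flatMap Clause.encode

/-- The language of GtMajority-`k`SAT: the encodings of the `k`-CNF formulas `F` whose number of
satisfying assignments is greater than `2 ^ (n - 1)`, where `n` is the number of variables of `F`
(the inequality is multiplied by `2`, which makes it meaningful for `n = 0` as well). -/
def GtMajorityKSAT (k : ℕ) : Language Γ' :=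
  {w | ∃ (n : ℕ) (F : CNF n), CNF.IsKCNF k F ∧ 2 ^ n < 2 * CNF.numSat F ∧ CNF.encode F = w}

open Classical in
/-- The complexity class `P`: the languages whose characteristic function is computed by a
deterministic Turing machine (with several stacks, i.e. work tapes) in a number of steps that is
bounded by a polynomial in the length of the input. -/
def InP {Γ : Type} (L : Language Γ) : Prop :=
  Nonempty (TM2ComputableInPolyTime (id : List Γ → List Γ) encodeBool fun w => decide (w ∈ L))

/-! The certificates are decision trees of constant depth. The density of satisfying assignments of
`F` is the average of the densities at the `2 ^ j` leaves of a complete tree of depth `j`, and a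
leaf refuted by unit propagation has density 0. Hence the density is at most `val j F / 2 ^ j`
(`two_pow_mul_count_le`). The heart of the proof is a converse: one depth `C` works for all 3-CNFs
without tautological clauses whose density is at most 1/2 (`exists_depth`). As `C` is a constant,
`val C F` can be compared with a constant in polynomial time.

The depth comes from a dichotomy. For each `t`, a formula of width `k` has `t` clauses on disjoint
variables, or at most `k * t` variables that hit all clauses. In the first case, asking for the
variables of these clauses leaves at most a fraction `(1 - 2 ^ (-k)) ^ t` of the leaves. In the
second, asking for the hitting variables leaves formulas of width `k - 1`. For width 3 and `t = 6`,
either `(7 / 8) ^ 6 < 1 / 2`, or the question becomes a bound on the sum of the counts of boundedly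
many 2-CNFs.

Such bounds, with weights and a natural number `θ` on the right, are certified by induction on the
multiset of widths (`exists_certifies`). If `θ = 0`, all formulas of positive weight are
unsatisfiable, and one query followed by unit propagation refutes an unsatisfiable 2-CNF
(`val_one_eq_zero`, the only place where width 2 is essential). If `θ ≥ 1`, either every formula has
many disjoint clauses and the sum is small enough, or some formula splits into narrower ones.

For the machine model, structured programs are compiled to stack machines. They compute on trees
written on a stack, and the functions computed in polynomial time are closed under pairing, case
distinction and folds of controlled growth. `inP_of_polyDec` carries the result to `InP`. -/

namespace StackProg

/-! ### Structured programs and their compilation to stack machines. -/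

/-- The stacks of the machine: input, output, the stack of values and two auxiliary stacks. -/
inductive Stk
  | inp | out | main | aux | cnt
  deriving DecidableEq

instance : Fintype Stk :=
  ⟨{.inp, .out, .main, .aux, .cnt}, fun k => by cases k <;> decide⟩

/-- The alphabets of the stacks. -/
def Sym : Stk → Type
  | .out => Bool
  | _ => Γ'

/-- The finite memory: the symbol that was popped last. -/
abbrev Reg := Option Γ'

/-- The contents of the stacks. -/
abbrev Store := ∀ k, List (Sym k)

/-- Structured programs over the stacks. -/
inductive Prog
  | push (k : Stk) (f : Reg → Sym k)
  | pop (k : Stk) (f : Reg → Option (Sym k) → Reg)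
  | seq (p q : Prog)
  | ite (c : Reg → Bool) (p q : Prog)
  | loop (c : Reg → Bool) (p : Prog)

/-- The program points of a structured program. -/
def Lab : Prog → Type
  | .push _ _ => Unit
  | .pop _ _ => Unit
  | .seq p q => Lab p ⊕ Lab q
  | .ite _ p q => Option (Lab p ⊕ Lab q)
  | .loop _ p => Option (Lab p)

instance Lab.fintype : (p : Prog) → Fintype (Lab p)
  | .push _ _ => inferInstanceAs (Fintype Unit)
  | .pop _ _ => inferInstanceAs (Fintype Unit)
  | .seq p q =>
    letI := Lab.fintype p
    letI := Lab.fintype q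
    inferInstanceAs (Fintype (Lab p ⊕ Lab q))
  | .ite _ p q =>
    letI := Lab.fintype p
    letI := Lab.fintype q
    inferInstanceAs (Fintype (Option (Lab p ⊕ Lab q)))
  | .loop _ p =>
    letI := Lab.fintype p
    inferInstanceAs (Fintype (Option (Lab p)))

/-- The program point where a program starts. -/
def entry : (p : Prog) → Lab p
  | .push _ _ => ()
  | .pop _ _ => ()
  | .seq p _ => Sum.inl (entry p)
  | .ite _ _ _ => none
  | .loop _ _ => none

/-- The statement that leaves a program for the label `nx`, or halts. -/
def exitTo {Λ : Type} : Option Λ → TM2.Stmt Sym Λ Reg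
  | none => .halt
  | some l => .goto fun _ => l

/-- The statements of a structured program whose labels are embedded by `e` and which continues
at `nx`. -/
def code : (p : Prog) → {Λ : Type} → (Lab p → Λ) → Option Λ → Lab p → TM2.Stmt Sym Λ Reg
  | .push k f, _, _, nx, _ => .push k f (exitTo nx)
  | .pop k f, _, _, nx, _ => .pop k f (exitTo nx)
  | .seq p q, _, e, _, .inl l =>
    code p (fun l => e (.inl l)) (some (e (.inr (entry q)))) l
  | .seq _ q, _, e, nx, .inr l => code q (fun l => e (.inr l)) nx l
  | .ite c p q, _, e, _, none =>
    .branch c (.goto fun _ => e (some (.inl (entry p)))) (.goto fun _ => e (some (.inr (entry q))))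
  | .ite _ p _, _, e, nx, some (.inl l) => code p (fun l => e (some (.inl l))) nx l
  | .ite _ _ q, _, e, nx, some (.inr l) => code q (fun l => e (some (.inr l))) nx l
  | .loop c p, _, e, nx, none => .branch c (.goto fun _ => e (some (entry p))) (exitTo nx)
  | .loop _ p, _, e, _, some l => code p (fun l => e (some l)) (some (e none)) l

/-- Started with memory `v` and stacks `S`, the program `p` ends with `v'` and `S'` after at most
`t` steps, in every machine of which it is a part. -/
def Exec (p : Prog) (v : Reg) (S : Store) (v' : Reg) (S' : Store) (t : ℕ) : Prop :=
  ∀ (Λ : Type) (M : Λ → TM2.Stmt Sym Λ Reg) (e : Lab p → Λ) (nx : Option Λ),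
    (∀ l, M (e l) = code p e nx l) →
    ∃ n ≤ t, (flip bind (TM2.step M))^[n] (some ⟨some (e (entry p)), v, S⟩) = some ⟨nx, v', S'⟩

theorem Exec.mono {p v S v' S' t t'} (h : Exec p v S v' S' t) (ht : t ≤ t') :
    Exec p v S v' S' t' := fun Λ M e nx hM =>
  let ⟨n, hn, h'⟩ := h Λ M e nx hM
  ⟨n, hn.trans ht, h'⟩

theorem stepAux_exitTo {Λ : Type} (nx : Option Λ) (v : Reg) (S : Store) :
    TM2.stepAux (exitTo nx) v S = ⟨nx, v, S⟩ := by
  cases nx <;> rfl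

theorem Exec.push {k f v} {S : Store} :
    Exec (.push k f) v S v (Function.update S k (f v :: S k)) 1 := by
  intro Λ M e nx hM
  refine ⟨1, le_rfl, ?_⟩
  have := hM ()
  simp only [code] at this
  simp [flip, TM2.step, entry, this, stepAux_exitTo]

theorem Exec.pop {k f v} {S : Store} :
    Exec (.pop k f) v S (f v (S k).head?) (Function.update S k (S k).tail) 1 := by
  intro Λ M e nx hM
  refine ⟨1, le_rfl, ?_⟩
  have := hM ()
  simp only [code] at this
  simp [flip, TM2.step, entry, this, stepAux_exitTo]

theorem Exec.seq {p q v S v' S' v'' S'' t t'} (hp : Exec p v S v' S' t)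
    (hq : Exec q v' S' v'' S'' t') : Exec (.seq p q) v S v'' S'' (t + t') := by
  intro Λ M e nx hM
  obtain ⟨n, hn, h⟩ := hp Λ M (fun l => e (.inl l)) (some (e (.inr (entry q))))
    (fun l => hM (.inl l))
  obtain ⟨n', hn', h'⟩ := hq Λ M (fun l => e (.inr l)) nx (fun l => hM (.inr l))
  refine ⟨n' + n, by omega, ?_⟩
  rw [Function.iterate_add_apply]
  exact (congrArg _ h).trans h'

theorem Exec.ite_true {c p q v S v' S' t} (hc : c v = true) (hp : Exec p v S v' S' t) :
    Exec (.ite c p q) v S v' S' (t + 1) := by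
  intro Λ M e nx hM
  obtain ⟨n, hn, h⟩ := hp Λ M (fun l => e (some (.inl l))) nx (fun l => hM (some (.inl l)))
  refine ⟨n + 1, by omega, ?_⟩
  have := hM none
  simp only [code] at this
  rw [Function.iterate_succ_apply]
  simpa [flip, entry, this, hc] using h

theorem Exec.ite_false {c p q v S v' S' t} (hc : c v = false) (hq : Exec q v S v' S' t) :
    Exec (.ite c p q) v S v' S' (t + 1) := by
  intro Λ M e nx hM
  obtain ⟨n, hn, h⟩ := hq Λ M (fun l => e (some (.inr l))) nx (fun l => hM (some (.inr l)))
  refine ⟨n + 1, by omega, ?_⟩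
  have := hM none
  simp only [code] at this
  rw [Function.iterate_succ_apply]
  simpa [flip, entry, this, hc] using h

theorem Exec.loop_false {c p v S} (hc : c v = false) : Exec (.loop c p) v S v S 1 := by
  intro Λ M e nx hM
  refine ⟨1, le_rfl, ?_⟩
  have := hM none
  simp only [code] at this
  simp [flip, TM2.step, entry, this, hc, stepAux_exitTo]

theorem Exec.loop_true {c p v S v' S' v'' S'' t t'} (hc : c v = true)
    (hp : Exec p v S v' S' t) (hl : Exec (.loop c p) v' S' v'' S'' t') :
    Exec (.loop c p) v S v'' S'' (t + t' + 1) := by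
  intro Λ M e nx hM
  obtain ⟨n, hn, h⟩ := hp Λ M (fun l => e (some l)) (some (e none)) (fun l => hM (some l))
  obtain ⟨n', hn', h'⟩ := hl Λ M e nx hM
  refine ⟨n' + (n + 1), by omega, ?_⟩
  have := hM none
  simp only [code] at this
  rw [Function.iterate_add_apply, Function.iterate_succ_apply]
  have h1 : flip bind (TM2.step M) (some ⟨some (e (entry (.loop c p))), v, S⟩) =
      some ⟨some (e (some (entry p))), v, S⟩ := by
    simp [flip, entry, this, hc]
  rw [h1]
  exact (congrArg _ h).trans h'

/-- The stacks with the given contents and an empty output. -/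
def mk (i m a c : List Γ') : Store
  | .inp => i
  | .out => []
  | .main => m
  | .aux => a
  | .cnt => c

variable (i m a c x : List Γ')

theorem update_inp : Function.update (mk i m a c) .inp x = mk x m a c := by
  funext k; cases k <;> rfl
theorem update_main : Function.update (mk i m a c) .main x = mk i x a c := by
  funext k; cases k <;> rfl
theorem update_aux : Function.update (mk i m a c) .aux x = mk i m x c := by
  funext k; cases k <;> rfl
theorem update_cnt : Function.update (mk i m a c) .cnt x = mk i m a x := by
  funext k; cases k <;> rfl

/-- The machine that runs a structured program. -/
def machine (p : Prog) : FinTM2 where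
  K := Stk
  k₀ := .inp
  k₁ := .out
  Γ := Sym
  Λ := Lab p
  main := entry p
  σ := Reg
  initialState := none
  Γk₀Fin := inferInstanceAs (Fintype Γ')
  m := code p id none

/-- A program that writes the answer of a decision problem within polynomial time yields membership
in `P`. -/
theorem inP_of_exec {L : Language Γ'} (p : Prog) (T : Polynomial ℕ)
    (h : ∀ w, ∃ b : Bool, (b = true ↔ w ∈ L) ∧
      Exec p none (mk w [] [] []) none (Function.update (mk [] [] [] []) .out [b])
        (T.eval w.length)) : InP L := by
  classical
  refine ⟨⟨⟨machine p, Equiv.refl _, Equiv.refl _⟩, T, fun w => ?_⟩⟩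
  have hex : ∃ n ≤ T.eval w.length, (flip bind (machine p).step)^[n]
      (some (initList (machine p) w)) = some (haltList (machine p) [decide (w ∈ L)]) := by
    obtain ⟨b, hb, hE⟩ := h w
    obtain ⟨n, hn, h'⟩ := hE (Lab p) (code p id none) id none (fun _ => rfl)
    refine ⟨n, hn, ?_⟩
    have hb' : decide (w ∈ L) = b := by
      rw [Bool.eq_iff_iff, hb, decide_eq_true_iff]
    have h1 : initList (machine p) w = ⟨some (entry p), none, mk w [] [] []⟩ := by
      simp only [initList]
      congr 1
      funext k
      cases k <;> rfl
    have h2 : haltList (machine p) [b] =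
        ⟨none, none, Function.update (mk [] [] [] []) .out [b]⟩ := by
      simp only [haltList]
      congr 1
      funext k
      cases k <;> rfl
    rw [hb', h1, h2]
    exact h'
  -- The definition of computability translates words along equivalences of alphabets, which are the
  -- identity here.
  have hmap : ∀ {α : Type} (l : List α), List.map (Equiv.refl α).invFun l = l := List.map_id
  refine ⟨⟨hex.choose, ?_⟩, hex.choose_spec.1⟩
  refine Eq.trans ?_ (hex.choose_spec.2.trans ?_)
  · exact congrArg (fun l => (flip bind (machine p).step)^[hex.choose]
      (some (initList (machine p) l))) (hmap _)
  · exact congrArg (fun l => some (haltList (machine p) l)) (hmap _).symm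

end StackProg

/-! ### Moving, dropping, duplicating and exchanging trees on a stack. -/

namespace StackProg

section Primitives

variable {i m a c : List Γ'} {v : Reg} {x : Γ'}

theorem Exec.pushMain {f : Reg → Γ'} :
    Exec (.push .main f) v (mk i m a c) v (mk i (f v :: m) a c) 1 := by
  rw [← update_main i m a c (f v :: m)]; exact Exec.push

theorem Exec.pushAux {f : Reg → Γ'} :
    Exec (.push .aux f) v (mk i m a c) v (mk i m (f v :: a) c) 1 := by
  rw [← update_aux i m a c (f v :: a)]; exact Exec.push

theorem Exec.pushCnt {f : Reg → Γ'} :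
    Exec (.push .cnt f) v (mk i m a c) v (mk i m a (f v :: c)) 1 := by
  rw [← update_cnt i m a c (f v :: c)]; exact Exec.push

theorem Exec.popInp {f : Reg → Option Γ' → Reg} :
    Exec (.pop .inp f) v (mk i m a c) (f v i.head?) (mk i.tail m a c) 1 := by
  rw [← update_inp i m a c i.tail]; exact Exec.pop

theorem Exec.popMain {f : Reg → Option Γ' → Reg} :
    Exec (.pop .main f) v (mk i (x :: m) a c) (f v (some x)) (mk i m a c) 1 := by
  rw [← update_main i (x :: m) a c m]; exact Exec.pop

theorem Exec.popAux {f : Reg → Option Γ' → Reg} :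
    Exec (.pop .aux f) v (mk i m (x :: a) c) (f v (some x)) (mk i m a c) 1 := by
  rw [← update_aux i m (x :: a) c a]; exact Exec.pop

theorem Exec.popCnt {f : Reg → Option Γ' → Reg} :
    Exec (.pop .cnt f) v (mk i m a c) (f v c.head?) (mk i m a c.tail) 1 := by
  rw [← update_cnt i m a c c.tail]; exact Exec.pop

end Primitives

/-- Binary trees, the values of the abstract machine. -/
inductive V
  | nil
  | cons (a b : V)

/-- The prefix encoding of a tree. -/
def V.str : V → List Γ'
  | .nil => [.bit false]
  | .cons a b => .bit true :: (a.str ++ b.str)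

/-- Tree codes consist of bits, so `bra` is free to mark the end of a tree on the auxiliary stack.
-/
theorem V.bra_notMem_str : ∀ t : V, Γ'.bra ∉ t.str
  | .nil => by simp [V.str]
  | .cons a b => by simp [V.str, V.bra_notMem_str a, V.bra_notMem_str b]

/-- The program `p` transforms the contents of the value stack and of the auxiliary stack as
stated within `t` steps. -/
def Run (p : Prog) (m a m' a' : List Γ') (t : ℕ) : Prop :=
  Exec p none (mk [] m a []) none (mk [] m' a' []) t

theorem Run.mono {p m a m' a' t t'} (h : Run p m a m' a' t) (ht : t ≤ t') : Run p m a m' a' t' :=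
  Exec.mono h ht

theorem Run.seq {p q m a m' a' m'' a'' t t'} (hp : Run p m a m' a' t)
    (hq : Run q m' a' m'' a'' t') : Run (.seq p q) m a m'' a'' (t + t') :=
  Exec.seq hp hq

/-- The memory stores `x`. -/
def load (x : Reg) : Prog := .pop .out fun _ _ => x

/-- Popping the output stack is harmless because it is empty; only a pop can change the memory. -/
theorem Exec.load {x v i m a c} : Exec (load x) v (mk i m a c) x (mk i m a c) 1 := by
  have h : Function.update (mk i m a c) .out [] = mk i m a c := by
    funext k; cases k <;> rfl
  have := Exec.pop (k := .out) (f := fun _ _ => x) (v := v) (S := mk i m a c)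
  rwa [show (mk i m a c .out).tail = [] from rfl, h] at this

/-- Is the stored symbol `x`? -/
def isSym (x : Γ') (v : Reg) : Bool := v = some x

/-- One round of `toAux`. -/
def toAuxBody : Prog :=
  .seq (.pop .main fun _ x => x) (.seq (.push .aux fun v => v.getD .blank)
    (.ite (isSym (.bit true)) (.push .cnt fun _ => .blank) (.pop .cnt fun _ x => x)))

/-- Move a tree from the value stack to the auxiliary stack, reversed and after a mark. -/
def toAux : Prog :=
  .seq (.push .aux fun _ => .bra) (.seq (load (some .blank)) (.loop Option.isSome toAuxBody))

/-- The height of the counter is the number of subtrees still owed after the current one: an inner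
node adds one, a leaf removes one. A leaf that finds the counter empty loads `none` and ends the
loop. The statement is in continuation form, so that the two subtrees of a node can be chained. -/
theorem exec_toAux_loop (t : V) : ∀ {m a c v v' S' T}, v.isSome = true →
    Exec (.loop Option.isSome toAuxBody) c.head? (mk [] m (t.str.reverse ++ a) c.tail) v' S' T →
    Exec (.loop Option.isSome toAuxBody) v (mk [] (t.str ++ m) a c) v' S'
      (T + 5 * t.str.length) := by
  induction t with
  | nil =>
    intro m a c v v' S' T hv h
    refine (Exec.loop_true hv (Exec.seq Exec.popMain (Exec.seq Exec.pushAux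
      (Exec.ite_false (by simp [isSym]) Exec.popCnt))) h).mono ?_
    simp [V.str]; omega
  | cons t u iht ihu =>
    intro m a c v v' S' T hv h
    have h1 := ihu (m := m) (a := t.str.reverse ++ .bit true :: a) (c := c) (v := some .blank)
      (v' := v') (S' := S') (T := T) rfl (by simpa [V.str] using h)
    have h2 := iht (m := u.str ++ m) (a := .bit true :: a) (c := .blank :: c) (v' := v')
      (v := some (.bit true)) (S' := S') rfl h1
    simp only [V.str, List.cons_append, List.append_assoc]
    refine (Exec.loop_true hv (Exec.seq Exec.popMain (Exec.seq Exec.pushAux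
      (Exec.ite_true (by simp [isSym]) Exec.pushCnt))) h2).mono ?_
    simp; omega

theorem run_toAux (t : V) {m a} :
    Run toAux (t.str ++ m) a m (t.str.reverse ++ .bra :: a) (5 * t.str.length + 3) := by
  have h := exec_toAux_loop t (m := m) (a := .bra :: a) (c := []) (v := some .blank) rfl
    (Exec.loop_false rfl)
  exact (Exec.seq Exec.pushAux (Exec.seq Exec.load h)).mono (by omega)

/-- One round of `fromAux`. -/
def fromAuxBody (bm bc : Bool) : Prog :=
  let p := Prog.pop .aux fun _ x => x
  let q := if bc then Prog.seq (.push .cnt fun v => v.getD .blank) p else p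
  if bm then .seq (.push .main fun v => v.getD .blank) q else q

/-- Move the auxiliary stack down to the mark to the value stack (if `bm`) and to the counter
stack (if `bc`). -/
def fromAux (bm bc : Bool) : Prog :=
  .seq (.pop .aux fun _ x => x) (.seq (.loop (fun v => !isSym .bra v) (fromAuxBody bm bc))
    (load none))

/-- The loop reads one symbol ahead: the top of the auxiliary stack is already in memory, hence
`head?` and `tail`. -/
theorem exec_fromAux_loop (bm bc : Bool) (l : List Γ') : ∀ {m a c}, Γ'.bra ∉ l →
    Exec (.loop (fun v => !isSym .bra v) (fromAuxBody bm bc)) (l ++ .bra :: a).head?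
      (mk [] m (l ++ .bra :: a).tail c) (some .bra)
      (mk [] (if bm then l.reverse ++ m else m) a (if bc then l.reverse ++ c else c))
      (4 * l.length + 1) := by
  induction l with
  | nil =>
    intro m a c _
    have : Exec (.loop (fun v => !isSym .bra v) (fromAuxBody bm bc)) (some .bra) (mk [] m a c)
      (some .bra) (mk [] m a c) 1 := Exec.loop_false (by simp [isSym])
    simpa using this
  | cons x l ih =>
    intro m a c hl
    have hx : (!isSym .bra (some x)) = true := by
      simp only [List.mem_cons, not_or] at hl
      simp [isSym, Ne.symm hl.1]
    obtain ⟨y, r, hr⟩ : ∃ y r, l ++ Γ'.bra :: a = y :: r := by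
      cases l <;> simp
    have ih' := @ih (if bm then x :: m else m) a (if bc then x :: c else c)
      (fun h => hl (List.mem_cons_of_mem _ h))
    rw [hr] at ih'
    simp only [List.cons_append, List.head?_cons, List.tail_cons, hr] at ih' ⊢
    have hb : Exec (fromAuxBody bm bc) (some x) (mk [] m (y :: r) c) (some y)
        (mk [] (if bm then x :: m else m) r (if bc then x :: c else c)) 3 := by
      cases bm <;> cases bc
      · exact Exec.popAux.mono (by omega)
      · exact (Exec.seq Exec.pushCnt Exec.popAux).mono (by omega)
      · exact (Exec.seq Exec.pushMain Exec.popAux).mono (by omega)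
      · exact (Exec.seq Exec.pushMain (Exec.seq Exec.pushCnt Exec.popAux)).mono (by omega)
    have := Exec.loop_true (p := fromAuxBody bm bc) (c := fun v => !isSym .bra v) hx hb ih'
    cases bm <;> cases bc <;> simp at this ⊢ <;> exact this.mono (by omega)

theorem exec_fromAux (bm bc : Bool) {l : List Γ'} (hl : Γ'.bra ∉ l) {m a c} :
    Exec (fromAux bm bc) none (mk [] m (l ++ .bra :: a) c) none
      (mk [] (if bm then l.reverse ++ m else m) a (if bc then l.reverse ++ c else c))
      (4 * l.length + 3) := by
  have h := exec_fromAux_loop bm bc l (m := m) (a := a) (c := c) hl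
  obtain ⟨y, r, hr⟩ : ∃ y r, l ++ Γ'.bra :: a = y :: r := by
    cases l <;> simp
  rw [hr] at h ⊢
  exact (Exec.seq Exec.popAux (Exec.seq h Exec.load)).mono (by omega)

/-- Move the counter stack to the auxiliary stack, after a mark. -/
def cntToAux : Prog :=
  .seq (.push .aux fun _ => .bra) (.seq (.pop .cnt fun _ x => x)
    (.loop Option.isSome (.seq (.push .aux fun v => v.getD .blank) (.pop .cnt fun _ x => x))))

theorem exec_cntToAux_loop (l : List Γ') : ∀ {m a},
    Exec (.loop Option.isSome (.seq (.push .aux fun v => v.getD .blank)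
      (.pop .cnt fun _ x => x))) l.head? (mk [] m a l.tail) none (mk [] m (l.reverse ++ a) [])
      (3 * l.length + 1) := by
  induction l with
  | nil => exact Exec.loop_false rfl
  | cons x l ih =>
    intro m a
    have h := Exec.loop_true (c := Option.isSome) (v := some x) rfl
      (Exec.seq (Exec.pushAux (f := fun v => v.getD .blank)) Exec.popCnt) (@ih m (x :: a))
    simpa using h.mono (by simp; omega)

theorem exec_cntToAux (l : List Γ') {m a} :
    Exec cntToAux none (mk [] m a l) none (mk [] m (l.reverse ++ .bra :: a) [])
      (3 * l.length + 3) :=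
  (Exec.seq Exec.pushAux (Exec.seq Exec.popCnt (exec_cntToAux_loop l))).mono (by omega)

theorem run_fromAux (t : V) {m a} :
    Run (fromAux true false) m (t.str.reverse ++ .bra :: a) (t.str ++ m) a
      (4 * t.str.length + 3) := by
  have := exec_fromAux true false (l := t.str.reverse) (by simpa using t.bra_notMem_str)
    (m := m) (a := a) (c := [])
  simpa [Run] using this

/-- Remove the top value. -/
def drop : Prog := .seq toAux (fromAux false false)

theorem run_drop (t : V) {m a} : Run drop (t.str ++ m) a m a (9 * t.str.length + 6) := by
  have := exec_fromAux false false (l := t.str.reverse) (by simpa using t.bra_notMem_str)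
    (m := m) (a := a) (c := [])
  exact (Exec.seq (run_toAux t) this).mono (by simp; omega)

/-- Move the counter stack to the value stack. -/
def cntToMain : Prog := .seq cntToAux (fromAux true false)

theorem exec_cntToMain (t : V) {m a} :
    Exec cntToMain none (mk [] m a t.str) none (mk [] (t.str ++ m) a []) (7 * t.str.length + 6) :=
  (Exec.seq (exec_cntToAux _) (run_fromAux t)).mono (by omega)

/-- Duplicate the top value. -/
def dup : Prog := .seq toAux (.seq (fromAux true true) cntToMain)

theorem run_dup (t : V) {m a} :
    Run dup (t.str ++ m) a (t.str ++ (t.str ++ m)) a (16 * t.str.length + 12) := by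
  have := exec_fromAux true true (l := t.str.reverse) (by simpa using t.bra_notMem_str)
    (m := m) (a := a) (c := [])
  simp only [if_true, List.reverse_reverse, List.append_nil] at this
  exact (Exec.seq (run_toAux t) (Exec.seq this (exec_cntToMain t))).mono (by simp; omega)

/-- Exchange the two values on top. -/
def swap : Prog :=
  .seq toAux (.seq toAux (.seq (fromAux false true) (.seq (fromAux true false) cntToMain)))

/-- On the auxiliary stack `u` lies above `t`. It waits on the counter stack while `t` returns, and
then goes on top of `t`. -/
theorem run_swap (t u : V) {m a} :
    Run swap (t.str ++ (u.str ++ m)) a (u.str ++ (t.str ++ m)) a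
      (16 * (t.str.length + u.str.length) + 18) := by
  have h1 := exec_fromAux false true (l := u.str.reverse) (by simpa using u.bra_notMem_str)
    (m := m) (a := t.str.reverse ++ .bra :: a) (c := [])
  have h2 := exec_fromAux true false (l := t.str.reverse) (by simpa using t.bra_notMem_str)
    (m := m) (a := a) (c := u.str)
  simp only [if_true, List.reverse_reverse, List.append_nil, Bool.false_eq_true, if_false]
    at h1 h2
  exact (Exec.seq (run_toAux t) (Exec.seq (run_toAux u) (Exec.seq h1
    (Exec.seq h2 (exec_cntToMain u))))).mono (by simp; omega)

end StackProg

/-! ### Functions computed in polynomial time. -/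

namespace StackProg

theorem eval_le_eval_of_le (P : Polynomial ℕ) {m n : ℕ} (h : m ≤ n) : P.eval m ≤ P.eval n := by
  simp only [Polynomial.eval_eq_sum, Polynomial.sum]
  gcongr

/-- Types whose elements are represented by trees. -/
class Enc (α : Type) where
  enc : α → V

export Enc (enc)

instance : Enc Bool := ⟨fun b => if b then .cons .nil .nil else .nil⟩

instance {α β : Type} [Enc α] [Enc β] : Enc (α × β) := ⟨fun p => .cons (enc p.1) (enc p.2)⟩

/-- The tree of a list. -/
def encList {α : Type} [Enc α] : List α → V
  | [] => .nil
  | a :: l => .cons (enc a) (encList l)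

instance {α : Type} [Enc α] : Enc (List α) := ⟨encList⟩

/-- The string on the value stack that represents `a`. -/
def str {α : Type} [Enc α] (a : α) : List Γ' := (enc a).str

/-- The length of the representation. -/
def size {α : Type} [Enc α] (a : α) : ℕ := (str a).length

section Str

variable {α β : Type} [Enc α] [Enc β]

theorem str_true : str true = [.bit true, .bit false, .bit false] := rfl
theorem str_false : str false = [.bit false] := rfl
theorem str_pair (a : α) (b : β) : str (a, b) = .bit true :: (str a ++ str b) := rfl
theorem str_nil : str ([] : List α) = [.bit false] := rfl
theorem str_cons (a : α) (l : List α) : str (a :: l) = .bit true :: (str a ++ str l) := rfl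

theorem size_pair (a : α) (b : β) : size (a, b) = size a + size b + 1 := by
  simp [size, str_pair]
theorem size_fst_le (p : α × β) : size p.1 ≤ size p := by
  obtain ⟨a, b⟩ := p
  simp only [size_pair]; omega
theorem size_snd_le (p : α × β) : size p.2 ≤ size p := by
  obtain ⟨a, b⟩ := p
  simp only [size_pair]; omega
theorem size_nil : size ([] : List α) = 1 := rfl
theorem size_cons (a : α) (l : List α) : size (a :: l) = size a + size l + 1 := by
  simp [size, str_cons]
theorem size_bool (b : Bool) : size b ≤ 3 := by
  cases b <;> simp [size, str_true, str_false]

theorem length_le_size (l : List α) : l.length ≤ size l := by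
  induction l with
  | nil => simp
  | cons a l ih => rw [size_cons, List.length_cons]; omega

theorem size_le_of_mem {a : α} {l : List α} (h : a ∈ l) : size a ≤ size l := by
  induction l with
  | nil => simp at h
  | cons b l ih =>
    rw [size_cons]
    rcases List.mem_cons.1 h with rfl | h
    · omega
    · have := ih h; omega

theorem size_append (l l' : List α) : size (l ++ l') + 1 = size l + size l' := by
  induction l with
  | nil => simp [size_nil, add_comm]
  | cons a l ih => simp only [List.cons_append, size_cons]; omega

theorem size_le_of_sublist {l l' : List α} (h : l.Sublist l') : size l ≤ size l' := by
  induction h with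
  | slnil => exact le_rfl
  | cons a _ ih => rw [size_cons]; omega
  | cons_cons a _ ih => rw [size_cons, size_cons]; omega

end Str

/-- `u` is bounded by a polynomial in the size of the argument. -/
def PolyBdd {α : Type} [Enc α] (u : α → ℕ) : Prop :=
  ∃ P : Polynomial ℕ, ∀ a, u a ≤ P.eval (size a)

namespace PolyBdd

variable {α β : Type} [Enc α] [Enc β] {u v : α → ℕ}

theorem mono (hv : PolyBdd v) (h : ∀ a, u a ≤ v a) : PolyBdd u :=
  let ⟨P, hP⟩ := hv
  ⟨P, fun a => (h a).trans (hP a)⟩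

theorem const (n : ℕ) : PolyBdd fun _ : α => n := ⟨Polynomial.C n, fun _ => by simp⟩

theorem size : PolyBdd fun a : α => size a := ⟨Polynomial.X, fun _ => by simp⟩

theorem add (hu : PolyBdd u) (hv : PolyBdd v) : PolyBdd fun a => u a + v a :=
  let ⟨P, hP⟩ := hu
  let ⟨Q, hQ⟩ := hv
  ⟨P + Q, fun a => by rw [Polynomial.eval_add]; exact add_le_add (hP a) (hQ a)⟩

theorem mul (hu : PolyBdd u) (hv : PolyBdd v) : PolyBdd fun a => u a * v a :=
  let ⟨P, hP⟩ := hu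
  let ⟨Q, hQ⟩ := hv
  ⟨P * Q, fun a => by rw [Polynomial.eval_mul]; exact Nat.mul_le_mul (hP a) (hQ a)⟩

theorem eval (P : Polynomial ℕ) (hu : PolyBdd u) : PolyBdd fun a => P.eval (u a) :=
  let ⟨Q, hQ⟩ := hu
  ⟨P.comp Q, fun a => by rw [Polynomial.eval_comp]; exact eval_le_eval_of_le P (hQ a)⟩

theorem comp {w : β → ℕ} {f : α → β} (hw : PolyBdd w)
    (hf : PolyBdd fun a => StackProg.size (f a)) : PolyBdd fun a => w (f a) :=
  let ⟨P, hP⟩ := hw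
  (hf.eval P).mono fun a => hP (f a)

end PolyBdd

/-- `f` is computed by a structured program on the value stack, in polynomial time. -/
def Poly {α β : Type} [Enc α] [Enc β] (f : α → β) : Prop :=
  ∃ (p : Prog) (T : α → ℕ), PolyBdd T ∧ (PolyBdd fun a => size (f a)) ∧
    ∀ a m x, Run p (str a ++ m) x (str (f a) ++ m) x (T a)

/-- Remove the symbol on top of the value stack. -/
def popSym : Prog := .pop .main fun _ _ => none

/-- Push a symbol on the value stack. -/
def pushSym (x : Γ') : Prog := .push .main fun _ => x

/-- Read and remove the symbol on top of the value stack. -/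
def readSym : Prog := .pop .main fun _ x => x

theorem run_popSym {x m a} : Run popSym (x :: m) a m a 1 := Exec.popMain

theorem run_pushSym {x m a} : Run (pushSym x) m a (x :: m) a 1 := Exec.pushMain

theorem run_load {m a} : Run (load none) m a m a 1 := Exec.load

/-- Push a string on the value stack. -/
def pushStr : List Γ' → Prog
  | [] => load none
  | x :: l => .seq (pushStr l) (pushSym x)

theorem exec_pushStr (l : List Γ') {v i m a c} :
    Exec (pushStr l) v (mk i m a c) none (mk i (l ++ m) a c) (l.length + 1) := by
  induction l with
  | nil => exact Exec.load
  | cons x l ih => exact (ih.seq Exec.pushMain).mono (by simp)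

theorem run_pushStr (l : List Γ') {m a} : Run (pushStr l) m a (l ++ m) a (l.length + 1) :=
  exec_pushStr l

namespace Poly

variable {α β γ σ : Type} [Enc α] [Enc β] [Enc γ] [Enc σ]

theorem size_le {f : α → β} (hf : Poly f) : PolyBdd fun a => size (f a) :=
  let ⟨_, _, _, h, _⟩ := hf
  h

/-- Only the tree matters, so data of different types with the same tree are converted at no cost.
-/
theorem of_enc_eq {f : α → β} {g : α → γ} (hg : Poly g) (h : ∀ a, enc (f a) = enc (g a)) :
    Poly f := by
  obtain ⟨p, T, hT, hs, hr⟩ := hg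
  have h' : ∀ a, str (f a) = str (g a) := fun a => congrArg V.str (h a)
  refine ⟨p, T, hT, hs.mono fun a => by simp [size, h'], fun a m x => ?_⟩
  rw [h']
  exact hr a m x

theorem id : Poly fun a : α => a :=
  ⟨load none, fun _ => 1, .const _, .size, fun _ _ _ => run_load⟩

/-- The size bound in `Poly` is what composition needs: the second program runs in time polynomial
in the size of the intermediate value. -/
theorem comp {g : β → γ} {f : α → β} (hg : Poly g) (hf : Poly f) : Poly fun a => g (f a) := by
  obtain ⟨p, T, hT, hs, hr⟩ := hf
  obtain ⟨p', T', hT', hs', hr'⟩ := hg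
  exact ⟨.seq p p', fun a => T a + T' (f a), hT.add (hT'.comp hs), hs'.comp hs,
    fun a m x => (hr a m x).seq (hr' (f a) m x)⟩

theorem const (b : β) : Poly fun _ : α => b :=
  ⟨.seq drop (pushStr (str b)), fun a => 9 * size a + 6 + ((str b).length + 1),
    (((PolyBdd.const 9).mul .size).add (.const 6)).add (.const _), .const _,
    fun a _ _ => (run_drop (enc a)).seq (run_pushStr _)⟩

theorem pair {f : α → β} {g : α → γ} (hf : Poly f) (hg : Poly g) : Poly fun a => (f a, g a) := by
  obtain ⟨p, T, hT, hs, hr⟩ := hf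
  obtain ⟨p', T', hT', hs', hr'⟩ := hg
  -- The second component is computed first, so that after the exchange the first one ends on top.
  refine ⟨.seq dup (.seq p' (.seq swap (.seq p (pushSym (.bit true))))),
    fun a => (16 * size a + 12) + (T' a + ((16 * (size (g a) + size a) + 18) + (T a + 1))),
    (((PolyBdd.const 16).mul .size).add (.const 12)).add (hT'.add
      ((((PolyBdd.const 16).mul (hs'.add .size)).add (.const 18)).add (hT.add (.const 1)))),
    ((hs.add hs').add (.const 1)).mono fun a => (size_pair _ _).le, fun a m x => ?_⟩
  rw [str_pair, List.cons_append, List.append_assoc]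
  exact (run_dup (enc a)).seq ((hr' a _ x).seq ((run_swap (enc (g a)) (enc a)).seq
    ((hr a _ x).seq run_pushSym)))

theorem fst' : Poly fun p : α × β => p.1 := by
  refine ⟨.seq popSym (.seq swap drop),
    fun p => 1 + ((16 * (size p) + 18) + (9 * size p + 6)),
    (PolyBdd.const 1).add ((((PolyBdd.const 16).mul .size).add (.const 18)).add
      (((PolyBdd.const 9).mul .size).add (.const 6))),
    PolyBdd.size.mono size_fst_le, fun p m x => ?_⟩
  obtain ⟨a, b⟩ := p
  rw [str_pair, List.cons_append, List.append_assoc]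
  refine (run_popSym.seq ((run_swap (enc a) (enc b)).seq (run_drop (enc b)))).mono ?_
  simp only [size_pair]
  simp only [size, str]
  omega

theorem snd' : Poly fun p : α × β => p.2 := by
  refine ⟨.seq popSym drop, fun p => 1 + (9 * size p + 6),
    (PolyBdd.const 1).add (((PolyBdd.const 9).mul .size).add (.const 6)),
    PolyBdd.size.mono size_snd_le, fun p m x => ?_⟩
  obtain ⟨a, b⟩ := p
  rw [str_pair, List.cons_append, List.append_assoc]
  refine (run_popSym.seq (run_drop (enc a))).mono ?_
  simp only [size_pair]
  simp only [size, str]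
  omega

theorem fst {f : α → β × γ} (hf : Poly f) : Poly fun a => (f a).1 := fst'.comp hf

theorem snd {f : α → β × γ} (hf : Poly f) : Poly fun a => (f a).2 := snd'.comp hf

theorem cons {f : α → β} {g : α → List β} (hf : Poly f) (hg : Poly g) :
    Poly fun a => f a :: g a :=
  (hf.pair hg).of_enc_eq fun _ => rfl

theorem cond {c : α → Bool} {f g : α → β} (hc : Poly c) (hf : Poly f) (hg : Poly g) :
    Poly fun a => if c a then f a else g a := by
  obtain ⟨p, T, hT, hs, hr⟩ := hf
  obtain ⟨p', T', hT', hs', hr'⟩ := hg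
  obtain ⟨p'', T'', hT'', -, hr''⟩ := hc
  -- The code of `false` is one symbol and that of `true` is three, hence two further pops in the
  -- positive case.
  refine ⟨.seq dup (.seq p'' (.seq readSym (.ite (isSym (.bit true))
      (.seq (load none) (.seq popSym (.seq popSym p))) (.seq (load none) p')))),
    fun a => (16 * size a + 12) + (T'' a + (1 + ((1 + (1 + (1 + (T a + T' a)))) + 1))),
    (((PolyBdd.const 16).mul .size).add (.const 12)).add (hT''.add ((PolyBdd.const 1).add
      (((PolyBdd.const 1).add ((PolyBdd.const 1).add ((PolyBdd.const 1).add (hT.add hT')))).add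
        (.const 1)))),
    (hs.add hs').mono fun a => by beta_reduce; split <;> omega, fun a m x => ?_⟩
  have h1 := hr'' a (str a ++ m) x
  cases hca : c a
  · rw [hca, str_false] at h1
    have e : (if c a = true then f a else g a) = g a := by simp [hca]
    beta_reduce
    rw [e]
    exact Run.mono ((run_dup (enc a)).seq (h1.seq (Exec.seq Exec.popMain
      (Exec.ite_false (by rfl) (Exec.seq Exec.load (hr' a m x))))))
      (by simp only [size, str]; omega)
  · rw [hca, str_true] at h1
    have e : (if c a = true then f a else g a) = f a := by simp [hca]
    beta_reduce
    rw [e]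
    exact Run.mono ((run_dup (enc a)).seq (h1.seq (Exec.seq Exec.popMain
      (Exec.ite_true (by rfl) (Exec.seq Exec.load (run_popSym.seq (run_popSym.seq
        (hr a m x)))))))) (by simp only [size, str]; omega)

/-- In prefix code, a cons cell is a tag followed by head and tail. Once the tag is read, two pair
symbols in front turn the rest of the stack into `((b, l), a)`. -/
theorem listCases {h : α → List β} {f : α → γ} {g : α → β → List β → γ} (hh : Poly h)
    (hf : Poly f) (hg : Poly fun p : (β × List β) × α => g p.2 p.1.1 p.1.2) :
    Poly fun a => match h a with
      | [] => f a
      | b :: l => g a b l := by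
  obtain ⟨p, T, hT, hs, hr⟩ := hf
  obtain ⟨p', T', hT', hs', hr'⟩ := hg
  obtain ⟨q, S, hS, hs'', hq⟩ := hh.pair Poly.id
  -- Regrouping preserves the size, so the bounds for `g` become bounds in `size (h a, a)`.
  have key : ∀ a b l, h a = b :: l → size ((b, l), a) = size (h a, a) := by
    intro a b l hl
    rw [hl]
    simp only [size_pair, size_cons]
  obtain ⟨P, hP⟩ := hT'
  obtain ⟨Q, hQ⟩ := hs'
  refine ⟨.seq q (.seq popSym (.seq readSym (.ite (isSym (.bit true))
      (.seq (load none) (.seq (pushSym (.bit true)) (.seq (pushSym (.bit true)) p')))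
        (.seq (load none) p)))),
    fun a => S a + (1 + (1 + ((1 + (1 + (1 + (T a + P.eval (size (h a, a)))))) + 1))),
    hS.add ((PolyBdd.const 1).add ((PolyBdd.const 1).add
      (((PolyBdd.const 1).add ((PolyBdd.const 1).add ((PolyBdd.const 1).add
        (hT.add (hs''.eval P))))).add (.const 1)))),
    (hs.add (hs''.eval Q)).mono fun a => ?_, fun a m x => ?_⟩
  · beta_reduce
    split
    · omega
    · next b l hl =>
      have := hQ ((b, l), a)
      rw [key a b l hl] at this
      exact this.trans (Nat.le_add_left _ _)
  · have h1 := hq a m x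
    rw [str_pair, List.cons_append, List.append_assoc] at h1
    beta_reduce
    cases hl : h a with
    | nil =>
      rw [hl, str_nil] at h1
      exact Run.mono (h1.seq (run_popSym.seq (Exec.seq Exec.popMain (Exec.ite_false (by rfl)
        (Exec.seq Exec.load (hr a m x)))))) (by omega)
    | cons b l =>
      have h2 := hr' ((b, l), a) m x
      rw [hl, str_cons, List.cons_append, List.append_assoc] at h1
      simp only [str_pair, List.cons_append, List.append_assoc] at h2
      have := hP ((b, l), a)
      rw [key a b l hl] at this
      rw [hl] at this
      exact Run.mono (h1.seq (run_popSym.seq (Exec.seq Exec.popMain (Exec.ite_true (by rfl)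
        (Exec.seq Exec.load (run_pushSym.seq (run_pushSym.seq h2))))))) (by omega)

end Poly

/-- One round of the fold with the step function `p`. -/
def foldBody (p : Prog) : Prog :=
  .seq (load none) (.seq swap (.seq toAux (.seq (pushSym (.bit true)) (.seq p
    (.seq (fromAux true false) readSym)))))

section Fold

variable {α β γ σ : Type} [Enc α] [Enc β] [Enc γ] [Enc σ]

/-- The memory holds the tag of the remaining list. In each round the tail is parked on the
auxiliary stack while `p` acts on the pair of head and state. `B` bounds the cost of `p` at the
states that really occur; moving head and tail costs at most `25 * Z` plus a constant. -/
theorem exec_foldLoop {p : Prog} {f : β × σ → σ} {T : β × σ → ℕ}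
    (hp : ∀ a m x, Run p (str a ++ m) x (str (f a) ++ m) x (T a)) {Z B : ℕ} {m x} (l : List β) :
    ∀ s : σ, (∀ l₁ b l₂, l = l₁ ++ b :: l₂ → T (b, l₁.foldl (fun s b => f (b, s)) s) ≤ B) →
    size l ≤ Z →
    Exec (.loop (isSym (.bit true)) (foldBody p)) (str l).head? (mk [] ((str l).tail ++
      (str s ++ m)) x []) (some (.bit false))
      (mk [] (str (l.foldl (fun s b => f (b, s)) s) ++ m) x [])
      (l.length * (B + 25 * Z + 30) + 1) := by
  induction l with
  | nil =>
    intro s _ _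
    exact (Exec.loop_false rfl).mono (by simp)
  | cons b l ih =>
    intro s hB hZ
    rw [size_cons] at hZ
    have ih' := ih (f (b, s)) (fun l₁ b' l₂ h => hB (b :: l₁) b' l₂ (by rw [h]; rfl)) (by omega)
    have hT := hB [] b l rfl
    obtain ⟨y, r, hyr⟩ : ∃ y r, str l = y :: r := by
      cases l
      · exact ⟨_, _, str_nil⟩
      · exact ⟨_, _, str_cons _ _⟩
    have hp' := hp (b, s) m ((enc l).str.reverse ++ .bra :: x)
    rw [str_pair, List.cons_append, List.append_assoc] at hp'
    have hpop : Exec readSym none (mk [] (str l ++ (str (f (b, s)) ++ m)) x [])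
        (str l).head? (mk [] ((str l).tail ++ (str (f (b, s)) ++ m)) x []) 1 := by
      rw [hyr]
      exact Exec.popMain
    have hbody : Exec (foldBody p) (some (.bit true)) (mk [] (str b ++ (str l ++ (str s ++ m))) x [])
        (str l).head? (mk [] ((str l).tail ++ (str (f (b, s)) ++ m)) x []) _ :=
      Exec.seq Exec.load (Exec.seq (run_swap (enc b) (enc l)) (Exec.seq (run_toAux (enc l))
        (Exec.seq run_pushSym (Exec.seq hp' (Exec.seq (run_fromAux (enc l)) hpop)))))
    have := Exec.loop_true (c := isSym (.bit true)) rfl hbody ih'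
    rw [str_cons, List.head?_cons, List.tail_cons, List.append_assoc]
    refine this.mono ?_
    simp only [List.foldl_nil] at hT
    have h3 : (enc b).str.length + (enc l).str.length ≤ Z := by
      simp only [size, str] at hZ
      omega
    rw [List.length_cons, Nat.add_mul, one_mul]
    omega

/-- Folding over a list is polynomial if the intermediate states have polynomial size. -/
theorem Poly.foldl_of_bdd {x : α → List β × σ} {f : β × σ → σ} (hx : Poly x) (hf : Poly f)
    {q : α → ℕ} (hq : PolyBdd q) (hb : ∀ a l₁ l₂, (x a).1 = l₁ ++ l₂ →
      size (l₁.foldl (fun s b => f (b, s)) (x a).2) ≤ q a) :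
    Poly fun a => (x a).1.foldl (fun s b => f (b, s)) (x a).2 := by
  obtain ⟨p, T, ⟨P, hP⟩, hs, hr⟩ := hf
  obtain ⟨p', T', hT', hs', hr'⟩ := hx
  have hl : PolyBdd fun a => size (x a).1 :=
    hs'.mono fun a => size_fst_le (x a)
  refine ⟨.seq p' (.seq popSym (.seq readSym (.seq (.loop (isSym (.bit true)) (foldBody p))
    (load none)))), fun a => T' a + (1 + (1 + ((size (x a).1 *
      (P.eval (size (x a).1 + q a + 1) + 25 * size (x a).1 + 30) + 1) + 1))),
    hT'.add ((PolyBdd.const 1).add ((PolyBdd.const 1).add (((hl.mul (((((hl.add hq).add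
      (.const 1)).eval P).add ((PolyBdd.const 25).mul hl)).add (.const 30))).add (.const 1)).add
        (.const 1)))),
    hq.mono fun a => hb a _ [] (by simp), fun a m y => ?_⟩
  have h1 := hr' a m y
  rw [← Prod.mk.eta (p := x a), str_pair, List.cons_append, List.append_assoc] at h1
  have h2 := exec_foldLoop hr (m := m) (x := y) (Z := size (x a).1)
    (B := P.eval (size (x a).1 + q a + 1)) (x a).1 (x a).2 (fun l₁ b l₂ h => by
      refine (hP _).trans (eval_le_eval_of_le P ?_)
      have h3 := hb a l₁ (b :: l₂) h
      have h4 : size b ≤ size (x a).1 := size_le_of_mem (by rw [h]; simp)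
      rw [size_pair]
      omega) le_rfl
  have hpop : Exec readSym none (mk [] (str (x a).1 ++ (str (x a).2 ++ m)) y [])
      (str (x a).1).head? (mk [] ((str (x a).1).tail ++ (str (x a).2 ++ m)) y []) 1 := by
    obtain ⟨z, r, hyr⟩ : ∃ z r, str (x a).1 = z :: r := by
      cases (x a).1
      · exact ⟨_, _, str_nil⟩
      · exact ⟨_, _, str_cons _ _⟩
    rw [hyr]
    exact Exec.popMain
  refine (h1.seq (run_popSym.seq (Exec.seq hpop (Exec.seq h2 Exec.load)))).mono ?_
  have := Nat.mul_le_mul_right (P.eval (size (x a).1 + q a + 1) + 25 * size (x a).1 + 30)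
    (length_le_size (x a).1)
  beta_reduce
  omega

/-- Folding over a list is polynomial if each step enlarges the state by a polynomial amount. -/
theorem Poly.foldl {h : α → List β} {i : α → σ} {f : α → β → σ → σ} (hh : Poly h) (hi : Poly i)
    (hf : Poly fun p : α × β × σ => f p.1 p.2.1 p.2.2) {g : α → ℕ} (hg : PolyBdd g)
    (hb : ∀ a, ∀ b ∈ h a, ∀ s, size (f a b s) ≤ size s + g a) :
    Poly fun a => (h a).foldl (fun s b => f a b s) (i a) := by
  -- The parameter `a` travels in the state, since the step function of `foldl_of_bdd` has no other
  -- access to it.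
  have hfold : ∀ a (l : List β) s,
      l.foldl (fun (s : α × σ) b => (s.1, f s.1 b s.2)) (a, s) =
        (a, l.foldl (fun s b => f a b s) s) := by
    intro a l
    induction l with
    | nil => intro s; rfl
    | cons b l ih => intro s; exact ih _
  have hsz : ∀ a (l : List β), (∀ b ∈ l, b ∈ h a) → ∀ s,
      size (l.foldl (fun s b => f a b s) s) ≤ size s + l.length * g a := by
    intro a l
    induction l with
    | nil => intro _ s; simp
    | cons b l ih =>
      intro hl s
      have h1 := ih (fun b hb => hl b (by simp [hb])) (f a b s)
      have h2 := hb a b (hl b (by simp)) s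
      rw [List.foldl_cons, List.length_cons, Nat.succ_mul]
      omega
  have hst : Poly fun p : β × (α × σ) => (p.2.1, f p.2.1 p.1 p.2.2) :=
    (Poly.id.snd.fst).pair (hf.comp (Poly.id.snd.fst.pair (Poly.id.fst.pair Poly.id.snd.snd)))
  have := (Poly.foldl_of_bdd (x := fun a => (h a, (a, i a)))
    (f := fun p => (p.2.1, f p.2.1 p.1 p.2.2))
    (q := fun a => size a + (size (i a) + size (h a) * g a) + 1)
    (hh.pair (Poly.id.pair hi)) hst
    ((PolyBdd.size.add (hi.size_le.add (hh.size_le.mul hg))).add (.const 1))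
    (fun a l₁ l₂ hl => by
      simp only at hl
      rw [hfold, size_pair]
      have h1 := hsz a l₁ (fun b hb => by rw [hl]; simp [hb]) (i a)
      have h2 : l₁.length ≤ size (h a) := by
        refine le_trans ?_ (length_le_size (h a))
        rw [hl]; simp
      have h3 := Nat.mul_le_mul_right (g a) h2
      omega)).snd
  simpa only [hfold] using this

theorem Poly.reverse {h : α → List β} (hh : Poly h) : Poly fun a => (h a).reverse := by
  have := Poly.foldl (i := fun _ : α => ([] : List β)) (f := fun _ b s => b :: s)
    (g := fun a => size (h a) + 1) hh
    (.const _) (Poly.id.snd.fst.cons Poly.id.snd.snd) (hh.size_le.add (.const 1))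
    (fun a b hb s => by rw [size_cons]; have := size_le_of_mem hb; omega)
  simpa using this

theorem Poly.foldr {h : α → List β} {i : α → σ} {f : α → β → σ → σ} (hh : Poly h) (hi : Poly i)
    (hf : Poly fun p : α × β × σ => f p.1 p.2.1 p.2.2) {g : α → ℕ} (hg : PolyBdd g)
    (hb : ∀ a, ∀ b ∈ h a, ∀ s, size (f a b s) ≤ size s + g a) :
    Poly fun a => (h a).foldr (fun b s => f a b s) (i a) := by
  simpa using Poly.foldl hh.reverse hi hf hg (fun a b hb' => hb a b (by simpa using hb'))

end Fold

end StackProg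

/-! ### Predicates decided in polynomial time, and operations on lists. -/

namespace StackProg

variable {α β γ σ : Type} [Enc α] [Enc β] [Enc γ] [Enc σ]

/-- `P` is decided in polynomial time. -/
def PolyDec (P : α → Prop) : Prop := ∃ c : α → Bool, Poly c ∧ ∀ a, c a = true ↔ P a

namespace PolyDec

variable {P Q : α → Prop}

theorem congr (hP : PolyDec P) (h : ∀ a, Q a ↔ P a) : PolyDec Q :=
  let ⟨c, hc, hc'⟩ := hP
  ⟨c, hc, fun a => (hc' a).trans (h a).symm⟩

theorem comp {P : β → Prop} {f : α → β} (hP : PolyDec P) (hf : Poly f) :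
    PolyDec fun a => P (f a) :=
  let ⟨c, hc, hc'⟩ := hP
  ⟨fun a => c (f a), hc.comp hf, fun a => hc' (f a)⟩

theorem const (p : Prop) : PolyDec fun _ : α => p := by
  classical
  exact ⟨fun _ => decide p, .const _, fun _ => by simp⟩

theorem ofBool {c : α → Bool} (hc : Poly c) : PolyDec fun a => c a = true := ⟨c, hc, fun _ => Iff.rfl⟩

theorem not (hP : PolyDec P) : PolyDec fun a => ¬P a :=
  let ⟨c, hc, hc'⟩ := hP
  ⟨fun a => if c a then false else true, hc.cond (.const _) (.const _), fun a => by simp [← hc']⟩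

theorem and (hP : PolyDec P) (hQ : PolyDec Q) : PolyDec fun a => P a ∧ Q a :=
  let ⟨c, hc, hc'⟩ := hP
  let ⟨d, hd, hd'⟩ := hQ
  ⟨fun a => if c a then d a else false, hc.cond hd (.const _), fun a => by simp [← hc', ← hd']⟩

theorem or (hP : PolyDec P) (hQ : PolyDec Q) : PolyDec fun a => P a ∨ Q a :=
  ((hP.not.and hQ.not).not).congr fun a => by tauto

theorem ite [DecidablePred P] {f g : α → β} (hP : PolyDec P) (hf : Poly f) (hg : Poly g) :
    Poly fun a => if P a then f a else g a := by
  obtain ⟨c, hc, hc'⟩ := hP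
  simp only [← hc']
  exact hc.cond hf hg

/-- A fold whose state is a truth value, so its size never exceeds 3. -/
theorem bex {P : α → β → Prop} {h : α → List β} (hP : PolyDec fun p : α × β => P p.1 p.2)
    (hh : Poly h) : PolyDec fun a => ∃ b ∈ h a, P a b := by
  obtain ⟨c, hc, hc'⟩ := hP
  refine ⟨fun a => (h a).foldr (fun b s => if c (a, b) then true else s) false,
    Poly.foldr hh (.const _) ((hc.comp (Poly.id.fst.pair Poly.id.snd.fst)).cond (.const _)
      Poly.id.snd.snd) (PolyBdd.const 3) (fun a b _ s => ?_), fun a => ?_⟩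
  · exact (size_bool _).trans (Nat.le_add_left _ _)
  · have key : ∀ l : List β, l.foldr (fun b s => if c (a, b) then true else s) false = true ↔
        ∃ b ∈ l, P a b := by
      intro l
      induction l with
      | nil => simp
      | cons b l ih =>
        have hab : c (a, b) = true ↔ P a b := hc' (a, b)
        rw [List.foldr_cons, List.exists_mem_cons_iff, ← ih, ← hab]
        cases c (a, b) <;> simp
    exact key (h a)

theorem ball {P : α → β → Prop} {h : α → List β} (hP : PolyDec fun p : α × β => P p.1 p.2)
    (hh : Poly h) : PolyDec fun a => ∀ b ∈ h a, P a b :=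
  ((bex (P := fun a b => ¬P a b) hP.not hh).not).congr fun a => by simp

theorem finite_ex {ι : Type} (s : Finset ι) {P : ι → α → Prop} (hP : ∀ i, PolyDec (P i)) :
    PolyDec fun a => ∃ i ∈ s, P i a := by
  classical
  induction s using Finset.induction_on with
  | empty => exact (const False).congr (by simp)
  | insert i s _ ih => exact ((hP i).or ih).congr (by simp)

end PolyDec

namespace Poly

theorem congr {f g : α → β} (hf : Poly f) (h : ∀ a, g a = f a) : Poly g :=
  (funext h : g = f) ▸ hf

theorem append {f g : α → List β} (hf : Poly f) (hg : Poly g) : Poly fun a => f a ++ g a := by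
  have := Poly.foldr (f := fun _ b (s : List β) => b :: s) (g := fun a => size (f a) + 1) hf hg
    (Poly.id.snd.fst.cons Poly.id.snd.snd) (hf.size_le.add (.const 1))
    (fun a b hb s => by rw [size_cons]; have := size_le_of_mem hb; omega)
  simpa using this

theorem flatMap {h : α → List β} {f : α → β → List γ} (hh : Poly h)
    (hf : Poly fun p : α × β => f p.1 p.2) : Poly fun a => (h a).flatMap (f a) := by
  obtain ⟨P, hP⟩ := hf.size_le
  have := Poly.foldr (i := fun _ => ([] : List γ)) (f := fun a b (s : List γ) => f a b ++ s)
    (g := fun a => P.eval (size a + size (h a) + 1)) hh (.const _)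
    ((hf.comp (Poly.id.fst.pair Poly.id.snd.fst)).append Poly.id.snd.snd)
    (((PolyBdd.size.add hh.size_le).add (.const 1)).eval P) (fun a b hb s => by
      have h1 := size_append (f a b) s
      have h2 := hP (a, b)
      have h3 : P.eval (size (a, b)) ≤ P.eval (size a + size (h a) + 1) :=
        eval_le_eval_of_le P (by rw [size_pair]; have := size_le_of_mem hb; omega)
      simp only at h2
      omega)
  have e : ∀ a, (h a).foldr (fun b s => f a b ++ s) [] = (h a).flatMap (f a) := by
    intro a
    induction h a with
    | nil => rfl
    | cons b l ih => simp [ih]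
  simpa only [e] using this

theorem map {h : α → List β} {f : α → β → γ} (hh : Poly h)
    (hf : Poly fun p : α × β => f p.1 p.2) : Poly fun a => (h a).map (f a) := by
  have := Poly.flatMap (f := fun a b => [f a b]) hh (hf.cons (.const []))
  have e : ∀ a, (h a).flatMap (fun b => [f a b]) = (h a).map (f a) := by
    intro a
    induction h a with
    | nil => rfl
    | cons b l ih => simp [ih]
  simpa only [e] using this

theorem filter {h : α → List β} {P : α → β → Prop} [∀ a, DecidablePred (P a)] (hh : Poly h)
    (hP : PolyDec fun p : α × β => P p.1 p.2) :
    Poly fun a => (h a).filter fun b => decide (P a b) := by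
  have := Poly.flatMap (f := fun a b => if P a b then [b] else []) hh
    (PolyDec.ite (P := fun p : α × β => P p.1 p.2) hP (Poly.id.snd.cons (.const []))
      (.const []))
  have e : ∀ a, (h a).flatMap (fun b => if P a b then [b] else []) =
      (h a).filter fun b => decide (P a b) := by
    intro a
    induction h a with
    | nil => rfl
    | cons b l ih =>
      rw [List.flatMap_cons, ih, List.filter_cons]
      by_cases hb : P a b <;> simp [hb]
  simpa only [e] using this

theorem flatten {h : α → List (List β)} (hh : Poly h) : Poly fun a => (h a).flatten := by
  simpa using Poly.flatMap (f := fun _ b => b) hh Poly.id.snd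

theorem tail {h : α → List β} (hh : Poly h) : Poly fun a => (h a).tail := by
  have := hh.listCases (f := fun _ => ([] : List β)) (g := fun _ _ l => l) (.const _)
    Poly.id.fst.snd
  exact this.congr fun a => by cases h a <;> rfl

end Poly

theorem PolyDec.eq_nil {h : α → List β} (hh : Poly h) : PolyDec fun a => h a = [] := by
  have := hh.listCases (f := fun _ => true) (g := fun _ _ _ => false) (.const _) (.const _)
  refine (PolyDec.ofBool this).congr fun a => ?_
  cases h a <;> simp

theorem PolyDec.length_le {h : α → List β} (hh : Poly h) (k : ℕ) :
    PolyDec fun a => (h a).length ≤ k := by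
  induction k generalizing h with
  | zero => exact (PolyDec.eq_nil hh).congr fun a => by simp
  | succ k ih => exact (ih hh.tail).congr fun a => by simp

/-- Types on which equality is decided in polynomial time. -/
class PolyEq (α : Type) [Enc α] : Prop where
  eq' : PolyDec fun p : α × α => p.1 = p.2

theorem PolyDec.eq [PolyEq β] {f g : α → β} (hf : Poly f) (hg : Poly g) :
    PolyDec fun a => f a = g a :=
  PolyEq.eq'.comp (hf.pair hg)

theorem PolyDec.mem [PolyEq β] {f : α → β} {g : α → List β} (hf : Poly f) (hg : Poly g) :
    PolyDec fun a => f a ∈ g a :=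
  (PolyDec.bex (P := fun a b => f a = b) (PolyDec.eq (hf.comp Poly.id.fst) Poly.id.snd) hg).congr
    fun a => by simp

instance : PolyEq Bool :=
  ⟨((PolyDec.ofBool Poly.id.fst).and (PolyDec.ofBool Poly.id.snd)).or
    ((PolyDec.ofBool Poly.id.fst).not.and (PolyDec.ofBool Poly.id.snd).not) |>.congr (by
      rintro ⟨a, b⟩; cases a <;> cases b <;> simp)⟩

instance [PolyEq α] [PolyEq β] : PolyEq (α × β) :=
  ⟨((PolyDec.eq Poly.id.fst.fst Poly.id.snd.fst).and
    (PolyDec.eq Poly.id.fst.snd Poly.id.snd.snd)).congr fun _ => Prod.ext_iff⟩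

/-- One step of the comparison of two lists: the second list loses its head. -/
def eqStep {δ : Type} [DecidableEq δ] (b : δ) (s : List δ × Bool) : List δ × Bool :=
  match s.1 with
  | [] => ([], false)
  | c :: l => (l, if b = c then s.2 else false)

/-- The state is the unread part of the second list with a flag for agreement so far. A second list
that is too short clears the flag, and one that is too long leaves a rest. -/
theorem foldl_eqStep {δ : Type} [DecidableEq δ] (l : List δ) : ∀ s : List δ × Bool,
    ((l.foldl (fun s b => eqStep b s) s).1 = [] ∧ (l.foldl (fun s b => eqStep b s) s).2 = true) ↔
      l = s.1 ∧ s.2 = true := by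
  induction l with
  | nil => exact fun s => and_congr_left' eq_comm
  | cons b l ih =>
    rintro ⟨r, k⟩
    rw [List.foldl_cons, ih]
    cases r with
    | nil => simp [eqStep]
    | cons c r =>
      by_cases h : b = c
      · subst h
        simp [eqStep]
      · simp [eqStep, h]

instance [PolyEq α] : PolyEq (List α) := by
  classical
  have hstep : Poly fun p : (List α × List α) × α × (List α × Bool) => eqStep p.2.1 p.2.2 :=
    Poly.listCases (h := fun p : (List α × List α) × α × (List α × Bool) => p.2.2.1)
      (f := fun _ => (([] : List α), false))
      (g := fun p c l => (l, if p.2.1 = c then p.2.2.2 else false)) Poly.id.snd.snd.fst (.const _)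
      (Poly.id.fst.snd.pair (PolyDec.ite (P := fun p : (α × List α) × (List α × List α) × α × (List α × Bool) =>
          p.2.2.1 = p.1.1)
        (PolyDec.eq Poly.id.snd.snd.fst Poly.id.fst.fst) Poly.id.snd.snd.snd.snd (.const _)))
  have := Poly.foldl (h := fun p : List α × List α => p.1) (i := fun p => (p.2, true))
    (f := fun _ b s => eqStep b s) (g := fun _ => 5) Poly.id.fst (Poly.id.snd.pair (.const _))
    hstep (.const 5) (fun p b _ s => by
      obtain ⟨r, k⟩ := s
      cases r with
      | nil =>
        have := size_bool false
        simp only [eqStep, size_pair, size_nil]; omega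
      | cons c r =>
        have := size_bool (if b = c then k else false)
        simp only [eqStep, size_pair, size_cons]; omega)
  refine ⟨((PolyDec.eq_nil this.fst).and (PolyDec.ofBool this.snd)).congr fun p => ?_⟩
  rw [foldl_eqStep]
  simp

/-- A code for the symbols of the alphabet. -/
def symCode : Γ' → Bool × Bool × Bool
  | .bit b => (true, b, false)
  | .comma => (false, true, true)
  | .bra => (false, true, false)
  | .ket => (false, false, true)
  | .blank => (false, false, false)

theorem symCode_injective : Function.Injective symCode := by decide

instance : Enc Γ' := ⟨fun x => enc (symCode x)⟩

theorem Poly.symCode {f : α → Γ'} (hf : Poly f) : Poly fun a => symCode (f a) :=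
  hf.of_enc_eq fun _ => rfl

theorem Poly.bit {f : α → Bool} (hf : Poly f) : Poly fun a => Γ'.bit (f a) :=
  Poly.of_enc_eq ((Poly.const true).pair (hf.pair (.const false))) fun _ => rfl

instance : PolyEq Γ' :=
  ⟨(PolyDec.eq Poly.id.fst.symCode Poly.id.snd.symCode).congr
    fun _ => symCode_injective.eq_iff.symm⟩

end StackProg

/-! ### Formulas, decision trees and unit propagation. -/

namespace LitCNF

/-- A CNF formula over an arbitrary type of variables; the literal `(b, v)` states `v = b`. -/
abbrev Formula (ν : Type) := List (List (Bool × ν))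

section Defs

variable {ν : Type}

/-- The complementary literal. -/
def neg (l : Bool × ν) : Bool × ν := (!l.1, l.2)

theorem neg_neg (l : Bool × ν) : neg (neg l) = l := by simp [neg]

/-- The assignment `a` satisfies `F`. -/
def Sat (a : ν → Bool) (F : Formula ν) : Prop := ∀ C ∈ F, ∃ l ∈ C, a l.2 = l.1

instance (a : ν → Bool) (F : Formula ν) : Decidable (Sat a F) :=
  inferInstanceAs (Decidable (∀ C ∈ F, ∃ l ∈ C, a l.2 = l.1))

/-- All clauses have at most `k` literals. -/
def Width (k : ℕ) (F : Formula ν) : Prop := ∀ C ∈ F, C.length ≤ k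

/-- No clause has complementary literals. -/
def Nontaut (F : Formula ν) : Prop := ∀ C ∈ F, ∀ l ∈ C, neg l ∉ C

variable [DecidableEq ν]

/-- The formula `F` after the assignment `v = b`. -/
def restrict (F : Formula ν) (v : ν) (b : Bool) : Formula ν :=
  (F.filter fun C => decide (¬(b, v) ∈ C)).map fun C => C.filter fun l => decide (¬l = (!b, v))

/-- One round of unit propagation. -/
def upStep (F : Formula ν) (D : List (Bool × ν)) : List (Bool × ν) :=
  F.flatten.filter fun l => decide (∃ C ∈ F, l ∈ C ∧ ∀ l' ∈ C, l' = l ∨ neg l' ∈ D)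

/-- The literals that are derived by unit propagation. -/
def upClosure (F : Formula ν) : List (Bool × ν) :=
  F.flatten.foldl (fun D _ => upStep F D) []

/-- Unit propagation falsifies a clause. -/
def Refuted (F : Formula ν) : Prop := ∃ C ∈ F, ∀ l ∈ C, neg l ∈ upClosure F

instance (F : Formula ν) : Decidable (Refuted F) :=
  inferInstanceAs (Decidable (∃ C ∈ F, ∀ l ∈ C, neg l ∈ upClosure F))

/-- The minimal number of leaves that are not refuted by unit propagation, among the decision trees
of depth `j`. -/
def val : ℕ → Formula ν → ℕ
  | 0, F => if Refuted F then 0 else 1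
  | j + 1, F => F.flatten.foldr
      (fun l m => min (val j (restrict F l.2 true) + val j (restrict F l.2 false)) m) (2 * val j F)

/-- The number of satisfying assignments. -/
def count [Fintype ν] (F : Formula ν) : ℕ := (Finset.univ.filter fun a => Sat a F).card

end Defs

section UnitPropagation

variable {ν : Type}

/-- Derivability by unit propagation. -/
inductive Der (F : Formula ν) : Bool × ν → Prop
  | unit {l C} (hC : C ∈ F) (hl : l ∈ C) (h : ∀ l' ∈ C, l' ≠ l → Der F (neg l')) : Der F l

theorem Der.mono {F G : Formula ν} (h : ∀ C ∈ F, C ∈ G) {l} (hl : Der F l) : Der G l := by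
  induction hl with
  | unit hC hl _ ih => exact .unit (h _ hC) hl ih

theorem Der.sound {F : Formula ν} {a} (ha : Sat a F) {l} (hl : Der F l) : a l.2 = l.1 := by
  induction hl with
  | @unit l C hC hl _ ih =>
    obtain ⟨l', hl', h⟩ := ha C hC
    by_cases he : l' = l
    · exact he ▸ h
    · have := ih l' hl' he
      simp [neg, h] at this

variable [DecidableEq ν]

/-- Each round filters the same list `F.flatten`, so a larger input yields a longer sublist. -/
theorem upStep_sublist {F : Formula ν} {D D' : List (Bool × ν)} (h : D ⊆ D') :
    (upStep F D).Sublist (upStep F D') := by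
  refine List.monotone_filter_right _ fun l hl => ?_
  simp only [decide_eq_true_eq] at hl ⊢
  obtain ⟨C, hC, hlC, h'⟩ := hl
  exact ⟨C, hC, hlC, fun l' hl' => (h' l' hl').imp_right fun h'' => h h''⟩

theorem upStep_iterate_sublist (F : Formula ν) (i : ℕ) :
    ((upStep F)^[i] []).Sublist ((upStep F)^[i + 1] []) := by
  induction i with
  | zero => simp
  | succ i ih =>
    rw [Function.iterate_succ_apply', Function.iterate_succ_apply' _ (i + 1)]
    exact upStep_sublist ih.subset

theorem upClosure_eq (F : Formula ν) : upClosure F = (upStep F)^[F.flatten.length] [] :=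
  List.foldl_const _ _ _

/-- The rounds form an increasing chain of sublists of `F.flatten`, which becomes stationary within
`F.flatten.length` rounds. -/
theorem upStep_upClosure (F : Formula ν) : upStep F (upClosure F) = upClosure F := by
  -- A chain that has not yet become stationary has gained an entry in every round.
  have key : ∀ i, (upStep F)^[i + 1] [] = (upStep F)^[i] [] ∨
      i + 1 ≤ ((upStep F)^[i + 1] []).length := by
    have hstep : ∀ i, (upStep F)^[i + 1] [] = (upStep F)^[i] [] ∨
        ((upStep F)^[i] []).length < ((upStep F)^[i + 1] []).length := fun i => by
      have h := upStep_iterate_sublist F i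
      rcases h.length_le.eq_or_lt with h' | h'
      · exact .inl (h.eq_of_length h').symm
      · exact .inr h'
    intro i
    induction i with
    | zero => exact (hstep 0).imp_right fun h => by omega
    | succ i ih =>
      rcases ih with h | h
      · left
        rw [Function.iterate_succ_apply' _ (i + 1), h, ← Function.iterate_succ_apply' (upStep F), h]
      · exact (hstep (i + 1)).imp_right fun h' => by omega
  rw [upClosure_eq, ← Function.iterate_succ_apply' (upStep F)]
  refine (key _).resolve_right fun h => ?_
  rw [Function.iterate_succ_apply'] at h
  have : (upStep F ((upStep F)^[F.flatten.length] [])).length ≤ F.flatten.length :=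
    List.length_filter_le _ _
  omega

theorem mem_upStep {F : Formula ν} {D l} :
    l ∈ upStep F D ↔ ∃ C ∈ F, l ∈ C ∧ ∀ l' ∈ C, l' = l ∨ neg l' ∈ D := by
  rw [upStep, List.mem_filter, decide_eq_true_iff, and_iff_right_iff_imp]
  rintro ⟨C, hC, hl, -⟩
  exact List.mem_flatten.2 ⟨C, hC, hl⟩

theorem mem_upClosure {F : Formula ν} {l} : l ∈ upClosure F ↔ Der F l := by
  constructor
  · rw [upClosure_eq]
    generalize F.flatten.length = i
    induction i generalizing l with
    | zero => simp
    | succ i ih =>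
      rw [Function.iterate_succ_apply', mem_upStep]
      rintro ⟨C, hC, hl, h⟩
      exact .unit hC hl fun l' hl' hne => ih ((h l' hl').resolve_left hne)
  · intro h
    induction h with
    | unit hC hl _ ih =>
      rw [← upStep_upClosure, mem_upStep]
      exact ⟨_, hC, hl, fun l' hl' => or_iff_not_imp_left.2 fun hne => ih l' hl' hne⟩

theorem refuted_iff {F : Formula ν} : Refuted F ↔ ∃ C ∈ F, ∀ l ∈ C, Der F (neg l) := by
  simp only [Refuted, mem_upClosure]

theorem Refuted.mono {F G : Formula ν} (h : ∀ C ∈ F, C ∈ G) (hF : Refuted F) : Refuted G := by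
  rw [refuted_iff] at hF ⊢
  obtain ⟨C, hC, h'⟩ := hF
  exact ⟨C, h C hC, fun l hl => (h' l hl).mono h⟩

theorem Refuted.not_sat {F : Formula ν} (hF : Refuted F) (a : ν → Bool) : ¬Sat a F := by
  intro ha
  obtain ⟨C, hC, h'⟩ := refuted_iff.1 hF
  obtain ⟨l, hl, h⟩ := ha C hC
  have := (h' l hl).sound ha
  simp [neg, h] at this

theorem refuted_of_nil_mem {F : Formula ν} (h : [] ∈ F) : Refuted F := ⟨[], h, by simp⟩

end UnitPropagation

/-! ### Restriction of a formula by an assignment to one variable. -/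

section Restrict

variable {ν : Type} [DecidableEq ν]

theorem mem_restrict {F : Formula ν} {v b C'} : C' ∈ restrict F v b ↔
    ∃ C ∈ F, (b, v) ∉ C ∧ C.filter (fun l => decide (¬l = (!b, v))) = C' := by
  simp [restrict, and_assoc]

theorem restrict_mono {F G : Formula ν} (h : ∀ C ∈ F, C ∈ G) (v : ν) (b : Bool) :
    ∀ C ∈ restrict F v b, C ∈ restrict G v b := by
  intro C hC
  obtain ⟨C', hC', h'⟩ := mem_restrict.1 hC
  exact mem_restrict.2 ⟨C', h _ hC', h'⟩

theorem Nontaut.restrict {F : Formula ν} (h : Nontaut F) (v b) : Nontaut (restrict F v b) := by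
  intro C hC l hl hn
  obtain ⟨C', hC', -, rfl⟩ := mem_restrict.1 hC
  exact h C' hC' l (List.mem_of_mem_filter hl) (List.mem_of_mem_filter hn)

theorem mem_restrict_of_disjoint {F : Formula ν} {v : ν} {b : Bool} {C} (hC : C ∈ F)
    (h : ∀ l ∈ C, l.2 ≠ v) : C ∈ restrict F v b := by
  refine mem_restrict.2 ⟨C, hC, fun h' => h _ h' rfl, List.filter_eq_self.2 fun l hl => ?_⟩
  have := h l hl
  simp only [decide_eq_true_eq]
  rintro rfl
  exact this rfl

theorem restrict_eq_self {F : Formula ν} {v : ν} (h : ∀ l ∈ F.flatten, l.2 ≠ v) (b : Bool) :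
    restrict F v b = F := by
  have h1 : ∀ C ∈ F, ∀ l ∈ C, l.2 ≠ v := fun C hC l hl => h l (List.mem_flatten.2 ⟨C, hC, hl⟩)
  have h2 : (F.filter fun C => decide (¬(b, v) ∈ C)) = F :=
    List.filter_eq_self.2 fun C hC => by
      simp only [decide_eq_true_eq]
      exact fun h' => h1 C hC _ h' rfl
  rw [restrict, h2]
  refine (List.map_congr_left fun C hC => ?_).trans (List.map_id F)
  refine List.filter_eq_self.2 fun l hl => ?_
  simp only [decide_eq_true_eq]
  rintro rfl
  exact h1 C hC _ hl rfl

theorem sat_restrict {F : Formula ν} {v : ν} {b : Bool} {a : ν → Bool} (h : a v = b) :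
    Sat a (restrict F v b) ↔ Sat a F := by
  constructor
  · intro h' C hC
    by_cases hv : (b, v) ∈ C
    · exact ⟨_, hv, h⟩
    · obtain ⟨l, hl, hl'⟩ := h' _ (mem_restrict.2 ⟨C, hC, hv, rfl⟩)
      exact ⟨l, List.mem_of_mem_filter hl, hl'⟩
  · intro h' C hC
    obtain ⟨C', hC', hv, rfl⟩ := mem_restrict.1 hC
    obtain ⟨l, hl, hl'⟩ := h' C' hC'
    refine ⟨l, List.mem_filter.2 ⟨hl, ?_⟩, hl'⟩
    simp only [decide_eq_true_eq]
    rintro rfl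
    simp [h] at hl'

theorem ne_of_mem_restrict {F : Formula ν} {v : ν} {b : Bool} {C} (hC : C ∈ restrict F v b) {l}
    (hl : l ∈ C) : l.2 ≠ v := by
  obtain ⟨C', hC', hv, rfl⟩ := mem_restrict.1 hC
  obtain ⟨hl, hne⟩ := List.mem_filter.1 hl
  obtain ⟨c, w⟩ := l
  simp only [decide_eq_true_eq] at hne
  rintro rfl
  cases b <;> cases c <;> simp_all

theorem sat_restrict_update {F : Formula ν} {v : ν} {b c : Bool} {a : ν → Bool} :
    Sat (Function.update a v c) (restrict F v b) ↔ Sat a (restrict F v b) := by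
  refine forall₂_congr fun C hC => exists_congr fun l => and_congr_right fun hl => ?_
  rw [Function.update_of_ne (ne_of_mem_restrict hC hl)]

/-- The variable `v` still counts but no longer occurs in `restrict F v b`, so each satisfying
assignment of `F` with `a v = b` is counted twice there. -/
theorem count_restrict [Fintype ν] (F : Formula ν) (v : ν) :
    count (restrict F v true) + count (restrict F v false) = 2 * count F := by
  have hsplit : ∀ G : Formula ν, count G = (Finset.univ.filter fun a => Sat a G ∧ a v = true).card +
      (Finset.univ.filter fun a => Sat a G ∧ a v = false).card := fun G => by
    rw [count, ← Finset.card_filter_add_card_filter_not (p := fun a : ν → Bool => a v = true),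
      Finset.filter_filter, Finset.filter_filter]
    simp only [Bool.not_eq_true]
  have hflip : ∀ b, (Finset.univ.filter fun a => Sat a (restrict F v b) ∧ a v = true).card =
      (Finset.univ.filter fun a => Sat a (restrict F v b) ∧ a v = false).card := fun b => by
    refine Finset.card_nbij' (fun a => Function.update a v false)
      (fun a => Function.update a v true) ?_ ?_ ?_ ?_
    · intro a ha
      simp at ha ⊢
      exact sat_restrict_update.2 ha.1
    · intro a ha
      simp at ha ⊢
      exact sat_restrict_update.2 ha.1
    · intro a ha
      simp at ha ⊢
      exact ha.2
    · intro a ha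
      simp at ha ⊢
      exact ha.2
  have heq : ∀ b, (Finset.univ.filter fun a => Sat a (restrict F v b) ∧ a v = b) =
      Finset.univ.filter fun a => Sat a F ∧ a v = b := fun b =>
    Finset.filter_congr fun a _ => and_congr_left fun h => sat_restrict h
  have h1 := hsplit (restrict F v true)
  have h2 := hsplit (restrict F v false)
  have h3 := hsplit F
  have h4 := congrArg Finset.card (heq true)
  have h5 := congrArg Finset.card (heq false)
  have h6 := hflip true
  have h7 := hflip false
  omega

end Restrict

end LitCNF

/-! ### One query and unit propagation are complete for 2-CNFs. -/

namespace LitCNF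

section Completeness

variable {ν : Type} [DecidableEq ν]

/-- A clause of a 2-CNF is satisfied by the literals derived after a decision, or not affected. -/
theorem touched_sat {F : Formula ν} (hF : Width 2 F) {v : ν} {b : Bool}
    (hG : ¬Refuted (restrict F v b)) {C} (hC : C ∈ F) {l} (hl : l ∈ C)
    (hn : neg l = (b, v) ∨ Der (restrict F v b) (neg l)) :
    ∃ l ∈ C, l = (b, v) ∨ Der (restrict F v b) l := by
  by_cases hv : (b, v) ∈ C
  · exact ⟨_, hv, .inl rfl⟩
  set C' := C.filter fun l => decide (¬l = (!b, v)) with hC'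
  have hmem : C' ∈ restrict F v b := mem_restrict.2 ⟨C, hC, hv, rfl⟩
  have hlen := hF C hC
  -- Otherwise `C'` would be falsified by derived literals. The surviving `l'` differs from the
  -- false literal `l`, so it is the only other literal of `C` and gets propagated.
  have hcon : ∃ l' ∈ C', ¬Der (restrict F v b) (neg l') := by
    by_contra! h
    exact hG (refuted_iff.2 ⟨C', hmem, h⟩)
  obtain ⟨l', hl', hn'⟩ := hcon
  have hl'C : l' ∈ C := List.mem_of_mem_filter hl'
  have hne : l' ≠ l := by
    rintro rfl
    rcases hn with hn | hn
    · have : l' = (!b, v) := by rw [← neg_neg l', hn]; rfl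
      simp [hC', this] at hl'
    · exact hn' hn
  have hC2 : ∀ x ∈ C, x = l ∨ x = l' := by
    intro x hx
    by_contra! hx'
    have : ([x, l, l'] : List _).Subperm C := by
      refine List.subperm_of_subset ?_ ?_
      · simp [hx'.1, hx'.2, hne.symm]
      · intro y hy
        simp only [List.mem_cons, List.not_mem_nil, or_false] at hy
        rcases hy with rfl | rfl | rfl <;> assumption
    have := this.length_le
    simp at this
    omega
  refine ⟨l', hl'C, .inr (.unit hmem hl' fun x hx hxne => ?_)⟩
  have hxl : x = l := (hC2 x (List.mem_of_mem_filter hx)).resolve_right hxne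
  subst hxl
  refine hn.resolve_left fun h => ?_
  have : x = (!b, v) := by rw [← neg_neg x, h]; rfl
  simp [hC', this] at hx

/-- Decide a variable that occurs, with a value that is not refuted. The decision and its
consequences satisfy every clause that they touch (`touched_sat`). The untouched clauses are a
smaller subformula, which inherits the hypotheses because refutation is monotone, and the two
assignments are glued. -/
theorem exists_sat_of_not_refuted {F : Formula ν} (hF : Width 2 F) (h0 : ¬Refuted F)
    (h1 : ∀ v, ∃ b, ¬Refuted (restrict F v b)) : ∃ a, Sat a F := by
  classical
  induction hn : F.length using Nat.strong_induction_on generalizing F with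
  | _ n ih =>
    by_cases hne : F.flatten = []
    · refine ⟨fun _ => true, fun C hC => (h0 (refuted_of_nil_mem ?_)).elim⟩
      rwa [← List.flatten_eq_nil_iff.1 hne C hC]
    obtain ⟨l₀, hl₀⟩ := List.exists_mem_of_ne_nil _ hne
    obtain ⟨C₀, hC₀, hl₀⟩ := List.mem_flatten.1 hl₀
    obtain ⟨b, hb⟩ := h1 l₀.2
    let D : Bool × ν → Prop := fun l => l = (b, l₀.2) ∨ Der (restrict F l₀.2 b) l
    -- If two complementary literals were derived, the clause that derives one of them would be
    -- falsified.
    have hcons : ∀ l, D l → ¬D (neg l) := by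
      have hder : ∀ l, Der (restrict F l₀.2 b) l → l.2 ≠ l₀.2 := by
        intro l hl
        obtain ⟨hC, hl, -⟩ := hl
        exact ne_of_mem_restrict hC hl
      have hnd : ∀ l, Der (restrict F l₀.2 b) l → ¬Der (restrict F l₀.2 b) (neg l) := by
        intro l hl hl'
        obtain ⟨hC, hlC, h⟩ := hl
        refine hb (refuted_iff.2 ⟨_, hC, fun x hx => ?_⟩)
        by_cases hxl : x = l
        · exact hxl ▸ hl'
        · exact h x hx hxl
      rintro l (rfl | hl) (hl' | hl')
      · simp [neg] at hl'
      · exact hder _ hl' rfl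
      · exact hder _ hl (by rw [← neg_neg l, hl']; rfl)
      · exact hnd l hl hl'
    let F' := F.filter fun C => decide (∀ l ∈ C, ¬D l ∧ ¬D (neg l))
    have hsub : ∀ C ∈ F', C ∈ F := fun C hC => List.mem_of_mem_filter hC
    have hlt : F'.length < n := by
      rw [← hn]
      refine lt_of_le_of_ne (List.length_filter_le _ _) fun h => ?_
      have := List.length_filter_eq_length_iff.1 h C₀ hC₀
      simp only [decide_eq_true_eq] at this
      have h' := this l₀ hl₀
      obtain ⟨c, w⟩ := l₀
      by_cases hcb : c = b
      · exact h'.1 (.inl (by simp [hcb]))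
      · refine h'.2 (.inl ?_)
        cases b <;> cases c <;> simp_all [neg]
    obtain ⟨a, ha⟩ := ih _ hlt (F := F') (fun C hC => hF C (hsub C hC))
      (fun h => h0 (h.mono hsub))
      (fun v => (h1 v).imp fun b hb h => hb (h.mono (restrict_mono hsub v b))) rfl
    refine ⟨fun w => if D (true, w) then true else if D (false, w) then false else a w,
      fun C hC => ?_⟩
    have hDsat : ∀ l, D l → (if D (true, l.2) then true else if D (false, l.2) then false
        else a l.2) = l.1 := by
      rintro ⟨c, w⟩ hl
      cases c with
      | true => simp [hl]
      | false =>
        have : ¬D (true, w) := hcons (false, w) hl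
        simp [hl, this]
    by_cases hCF : C ∈ F'
    · obtain ⟨l, hl, hal⟩ := ha C hCF
      have h' := (List.mem_filter.1 hCF).2
      simp only [decide_eq_true_eq] at h'
      have h'' := h' l hl
      refine ⟨l, hl, ?_⟩
      obtain ⟨c, w⟩ := l
      cases c <;> simp_all [neg]
    · have h' : ¬∀ l ∈ C, ¬D l ∧ ¬D (neg l) := fun h =>
        hCF (List.mem_filter.2 ⟨hC, by simpa using h⟩)
      push Not at h'
      obtain ⟨l, hl, hl'⟩ := h'
      by_cases hDl : D l
      · exact ⟨l, hl, hDsat l hDl⟩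
      · obtain ⟨l', hl'C, hl''⟩ := touched_sat hF hb hC hl (hl' hDl)
        exact ⟨l', hl'C, hDsat l' hl''⟩

end Completeness

/-! ### Bounds for decision trees. -/

section Val

variable {ν : Type} [DecidableEq ν]

theorem val_succ_le_iff {j s : ℕ} {F : Formula ν} : val (j + 1) F ≤ s ↔ 2 * val j F ≤ s ∨
    ∃ l ∈ F.flatten, val j (restrict F l.2 true) + val j (restrict F l.2 false) ≤ s := by
  rw [val]
  induction F.flatten with
  | nil => simp
  | cons l L ih => rw [List.foldr_cons, min_le_iff, ih, List.exists_mem_cons_iff]; tauto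

theorem val_succ_le_two_mul (j : ℕ) (F : Formula ν) : val (j + 1) F ≤ 2 * val j F :=
  val_succ_le_iff.2 (.inl le_rfl)

/-- Levels without a question only double the leaves. -/
theorem val_add_le (j d : ℕ) (F : Formula ν) : val (j + d) F ≤ 2 ^ d * val j F := by
  induction d with
  | zero => simp
  | succ d ih =>
    refine (val_succ_le_two_mul (j + d) F).trans ?_
    rw [pow_succ, mul_assoc, mul_left_comm]
    omega

theorem val_le_pow (j : ℕ) (F : Formula ν) : val j F ≤ 2 ^ j := by
  have h := val_add_le 0 j F
  rw [zero_add] at h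
  refine h.trans ?_
  rw [val]
  split <;> simp

theorem val_of_refuted {F : Formula ν} (h : Refuted F) (j : ℕ) : val j F = 0 := by
  have h' := val_add_le 0 j F
  rw [zero_add, val, if_pos h] at h'
  omega

/-- A variable that does not occur may be asked too: both restrictions are `F` itself. -/
theorem val_succ_le (j : ℕ) (F : Formula ν) (v : ν) :
    val (j + 1) F ≤ val j (restrict F v true) + val j (restrict F v false) := by
  by_cases h : ∃ l ∈ F.flatten, l.2 = v
  · obtain ⟨l, hl, rfl⟩ := h
    exact val_succ_le_iff.2 (.inr ⟨l, hl, le_rfl⟩)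
  · push Not at h
    rw [restrict_eq_self h, restrict_eq_self h, ← two_mul]
    exact val_succ_le_two_mul j F

/-- Decision trees bound the number of satisfying assignments. -/
theorem two_pow_mul_count_le [Fintype ν] (j : ℕ) (F : Formula ν) :
    2 ^ j * count F ≤ val j F * 2 ^ Fintype.card ν := by
  induction j generalizing F with
  | zero =>
    rw [val]
    split
    · next h =>
      simp only [zero_mul, pow_zero, one_mul, nonpos_iff_eq_zero]
      exact Finset.card_eq_zero.2 (Finset.filter_eq_empty_iff.2 fun a _ => h.not_sat a)
    · simpa [count] using Finset.card_filter_le (s := Finset.univ) (p := fun a => Sat a F)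
  | succ j ih =>
    rcases val_succ_le_iff.1 (le_refl (val (j + 1) F)) with h | ⟨l, -, h⟩
    · have := ih F
      have h' := Nat.mul_le_mul_right (2 ^ Fintype.card ν) h
      rw [pow_succ]
      nlinarith
    · have h1 := ih (restrict F l.2 true)
      have h2 := ih (restrict F l.2 false)
      have h3 := count_restrict F l.2
      have h' := Nat.mul_le_mul_right (2 ^ Fintype.card ν) h
      calc 2 ^ (j + 1) * count F = 2 ^ j * (2 * count F) := by ring
        _ ≤ _ := by rw [← h3, mul_add]; rw [add_mul] at h'; omega

/-- By completeness, an unsatisfiable 2-CNF is refuted at once or has a variable both of whose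
values are refuted. -/
theorem val_one_eq_zero {F : Formula ν} (hF : Width 2 F) (h : ∀ a, ¬Sat a F) : val 1 F = 0 := by
  by_cases h0 : Refuted F
  · exact val_of_refuted h0 1
  have h1 : ¬∀ v, ∃ b, ¬Refuted (restrict F v b) := fun h1 => by
    obtain ⟨a, ha⟩ := exists_sat_of_not_refuted hF h0 h1
    exact h a ha
  push Not at h1
  obtain ⟨v, hv⟩ := h1
  have := val_succ_le 0 F v
  rw [val_of_refuted (hv true), val_of_refuted (hv false)] at this
  exact Nat.le_zero.1 this

/-- The formulas at the leaves of the decision tree that asks for the given variables. -/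
def expand (F : Formula ν) : List ν → List (Formula ν)
  | [] => [F]
  | v :: vs => expand (restrict F v true) vs ++ expand (restrict F v false) vs

theorem length_expand (F : Formula ν) (vs : List ν) : (expand F vs).length = 2 ^ vs.length := by
  induction vs generalizing F with
  | nil => rfl
  | cons v vs ih => rw [expand, List.length_append, ih, ih, List.length_cons, pow_succ]; omega

/-- Ask for `vs`, then use an optimal tree at each leaf. -/
theorem val_le_sum_expand (j : ℕ) (F : Formula ν) (vs : List ν) :
    val (j + vs.length) F ≤ ((expand F vs).map (val j)).sum := by
  induction vs generalizing F with
  | nil => simp [expand]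
  | cons v vs ih =>
    rw [expand, List.map_append, List.sum_append, List.length_cons, ← add_assoc]
    exact (val_succ_le _ F v).trans (add_le_add (ih _) (ih _))

theorem sum_count_expand [Fintype ν] (F : Formula ν) (vs : List ν) :
    ((expand F vs).map count).sum = 2 ^ vs.length * count F := by
  induction vs generalizing F with
  | nil => simp [expand]
  | cons v vs ih =>
    rw [expand, List.map_append, List.sum_append, ih, ih, ← mul_add, count_restrict,
      List.length_cons]
    ring

theorem Nontaut.expand {F : Formula ν} (h : Nontaut F) (vs : List ν) :
    ∀ G ∈ expand F vs, Nontaut G := by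
  induction vs generalizing F with
  | nil => simpa [LitCNF.expand] using h
  | cons v vs ih =>
    intro G hG
    rcases List.mem_append.1 hG with hG | hG
    · exact ih (h.restrict v true) G hG
    · exact ih (h.restrict v false) G hG

theorem mem_of_mem_expand {F : Formula ν} {C} (hC : C ∈ F) (vs : List ν)
    (h : ∀ l ∈ C, l.2 ∉ vs) : ∀ G ∈ expand F vs, C ∈ G := by
  induction vs generalizing F with
  | nil => simpa [expand] using hC
  | cons v vs ih =>
    intro G hG
    have h1 : ∀ l ∈ C, l.2 ≠ v := fun l hl he => h l hl (by simp [he])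
    have h2 : ∀ l ∈ C, l.2 ∉ vs := fun l hl he => h l hl (by simp [he])
    rcases List.mem_append.1 hG with hG | hG
    · exact ih (mem_restrict_of_disjoint hC h1) h2 G hG
    · exact ih (mem_restrict_of_disjoint hC h1) h2 G hG

/-- Asking for the variables of a hitting set reduces the width. -/
theorem width_expand {F : Formula ν} {k : ℕ} (vs : List ν)
    (h : ∀ C ∈ F, C.length ≤ k ∨ C.length ≤ k + 1 ∧ ∃ l ∈ C, l.2 ∈ vs) :
    ∀ G ∈ expand F vs, Width k G := by
  induction vs generalizing F with
  | nil =>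
    simp only [expand, List.mem_singleton, forall_eq]
    intro C hC
    rcases h C hC with h | ⟨-, l, -, hl⟩
    · exact h
    · simp at hl
  | cons v vs ih =>
    -- A surviving clause that was hit at `v` has lost a literal; any other hit remains for `vs`.
    have key : ∀ b, ∀ C ∈ restrict F v b,
        C.length ≤ k ∨ C.length ≤ k + 1 ∧ ∃ l ∈ C, l.2 ∈ vs := by
      intro b C hC
      obtain ⟨C', hC', hv, rfl⟩ := mem_restrict.1 hC
      have hle := List.length_filter_le (fun l => decide (¬l = (!b, v))) C'
      rcases h C' hC' with h' | ⟨h', l, hl, hlv⟩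
      · exact .inl (hle.trans h')
      by_cases hlb : l = (!b, v)
      · left
        have : (C'.filter fun l => decide (¬l = (!b, v))).length < C'.length := by
          refine lt_of_le_of_ne hle fun he => ?_
          have := List.length_filter_eq_length_iff.1 he l hl
          simp [hlb] at this
        omega
      · right
        refine ⟨hle.trans h', l, List.mem_filter.2 ⟨hl, by simpa using hlb⟩, ?_⟩
        refine (List.mem_cons.1 hlv).resolve_left fun hlv => ?_
        obtain ⟨c, w⟩ := l
        cases b <;> cases c <;> simp_all
    intro G hG
    rcases List.mem_append.1 hG with hG | hG
    · exact ih (key true) G hG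
    · exact ih (key false) G hG

/-- One of the leaves of the tree that asks for all variables of a clause falsifies the clause. -/
theorem sum_val_expand_le {F : Formula ν} {j M : ℕ} (ls C : List (Bool × ν)) (hC : C ∈ F)
    (hCl : C ⊆ ls) (hls : ∀ l ∈ ls, neg l ∉ ls)
    (hM : ∀ G ∈ expand F (ls.map Prod.snd), val j G ≤ M) :
    ((expand F (ls.map Prod.snd)).map (val j)).sum ≤ (2 ^ ls.length - 1) * M := by
  induction ls generalizing F C with
  | nil =>
    have : C = [] := List.subset_nil.1 hCl
    subst this
    simp [expand, val_of_refuted (refuted_of_nil_mem hC)]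
  | cons l ls ih =>
    obtain ⟨b, v⟩ := l
    simp only [List.map_cons, expand, List.mem_append, List.map_append, List.sum_append] at hM ⊢
    have hls' : ∀ l ∈ ls, neg l ∉ ls := fun l hl hn => hls l (by simp [hl]) (by simp [hn])
    -- The branch that falsifies the head of `ls` keeps the rest of the clause inside the tail, so
    -- induction applies; the other branch gets the trivial bound.
    have hb : ((expand (restrict F v (!b)) (ls.map Prod.snd)).map (val j)).sum ≤
        (2 ^ ls.length - 1) * M := by
      refine ih (C.filter fun l => decide (¬l = (!!b, v))) ?_ ?_ hls' ?_
      · refine mem_restrict.2 ⟨C, hC, fun h => ?_, rfl⟩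
        exact hls (b, v) (by simp) (hCl h)
      · intro l hl
        obtain ⟨hl, hne⟩ := List.mem_filter.1 hl
        rw [Bool.not_not, decide_eq_true_eq] at hne
        exact (List.mem_cons.1 (hCl hl)).resolve_left hne
      · intro G hG
        cases b
        · exact hM G (.inl hG)
        · exact hM G (.inr hG)
    have hb' : ((expand (restrict F v b) (ls.map Prod.snd)).map (val j)).sum ≤
        2 ^ ls.length * M := by
      have hle : ∀ x ∈ (expand (restrict F v b) (ls.map Prod.snd)).map (val j), x ≤ M := by
        intro x hx
        obtain ⟨G, hG, rfl⟩ := List.mem_map.1 hx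
        cases b
        · exact hM G (.inr hG)
        · exact hM G (.inl hG)
      refine (List.sum_le_card_nsmul _ _ hle).trans ?_
      simp [length_expand]
    have hpow : (2 ^ (ls.length + 1) - 1) * M = (2 ^ ls.length - 1) * M + 2 ^ ls.length * M := by
      rw [← add_mul]
      have := Nat.one_le_two_pow (n := ls.length)
      congr 1
      omega
    rw [List.length_cons, hpow]
    cases b
    · simp only [Bool.not_false] at hb; omega
    · simp only [Bool.not_true] at hb; omega

/-- `cs` are clauses of `F` with pairwise disjoint sets of variables. -/
def DisjointClauses (F : Formula ν) (cs : List (List (Bool × ν))) : Prop :=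
  (∀ C ∈ cs, C ∈ F) ∧ cs.Pairwise fun C C' => ∀ l ∈ C, ∀ l' ∈ C', l.2 ≠ l'.2

/-- Asking for all variables of one clause loses a leaf and leaves the other clauses intact at every
leaf, so the factors multiply. -/
theorem DisjointClauses.val_le {F : Formula ν} {cs} (h : DisjointClauses F cs) {k : ℕ}
    (hk : Width k F) (hF : Nontaut F) : val (k * cs.length) F ≤ (2 ^ k - 1) ^ cs.length := by
  obtain ⟨hmem, hdisj⟩ := h
  have hlen : ∀ C ∈ cs, C.length ≤ k := fun C hC => hk C (hmem C hC)
  clear hk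
  induction cs generalizing F with
  | nil => exact (val_le_pow 0 F)
  | cons C cs ih =>
    obtain ⟨hC, hcs⟩ := List.pairwise_cons.1 hdisj
    have hM : ∀ G ∈ expand F (C.map Prod.snd),
        val (k * cs.length) G ≤ (2 ^ k - 1) ^ cs.length := fun G hG => by
      refine ih (hF.expand _ G hG) (fun C' hC' => ?_) hcs (fun C' hC' => hlen C' (by simp [hC']))
      refine mem_of_mem_expand (hmem C' (by simp [hC'])) _ (fun l hl hv => ?_) G hG
      obtain ⟨l', hl', he⟩ := List.mem_map.1 hv
      exact hC C' hC' l' hl' l hl he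
    have h1 := sum_val_expand_le C C (hmem C (by simp)) (fun _ h => h) (hF C (hmem C (by simp))) hM
    have h2 := (val_le_sum_expand (k * cs.length) F (C.map Prod.snd)).trans h1
    rw [List.length_map] at h2
    have hCk := hlen C (by simp)
    -- A clause of width `c < k` is padded by `k - c` idle levels, and `2 ^ (k - c) * (2 ^ c - 1) ≤
    -- 2 ^ k - 1`.
    have h3 := val_add_le (k * cs.length + C.length) (k - C.length) F
    have h4 : k * cs.length + C.length + (k - C.length) = k * (C :: cs).length := by
      rw [List.length_cons, Nat.mul_succ]; omega
    rw [h4] at h3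
    refine h3.trans ((Nat.mul_le_mul_left _ h2).trans ?_)
    rw [List.length_cons, pow_succ, ← mul_assoc, mul_comm ((2 ^ k - 1) ^ cs.length)]
    refine Nat.mul_le_mul_right _ ?_
    rw [Nat.mul_sub, ← pow_add, mul_one]
    have h5 : k - C.length + C.length = k := by omega
    have := Nat.one_le_two_pow (n := k - C.length)
    rw [h5]
    omega

/-- A formula has many disjoint clauses or a small hitting set. -/
theorem exists_disjointClauses_or_hitting {F : Formula ν} {k : ℕ} (hF : Width k F) (t : ℕ) :
    (∃ cs, cs.length = t ∧ DisjointClauses F cs) ∨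
      ∃ vs : List ν, vs.length ≤ k * t ∧ ∀ C ∈ F, ∃ l ∈ C, l.2 ∈ vs := by
  induction t with
  | zero => exact .inl ⟨[], rfl, by simp [DisjointClauses]⟩
  | succ t ih =>
    rcases ih with ⟨cs, hcs, hmem, hdisj⟩ | ⟨vs, hvs, h⟩
    -- Greedy choice: either the variables of the family hit every clause, or a missed clause
    -- extends it. An empty clause is always missed and may be repeated.
    · by_cases h : ∀ C ∈ F, ∃ l ∈ C, l.2 ∈ cs.flatten.map Prod.snd
      · refine .inr ⟨_, ?_, h⟩
        rw [List.length_map, List.length_flatten, Nat.mul_succ]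
        have : (cs.map List.length).sum ≤ (cs.map List.length).length • k :=
          List.sum_le_card_nsmul _ _ fun x hx => by
            obtain ⟨C, hC, rfl⟩ := List.mem_map.1 hx
            exact hF C (hmem C hC)
        rw [List.length_map, hcs, smul_eq_mul, mul_comm] at this
        omega
      · push Not at h
        obtain ⟨C, hC, hCv⟩ := h
        refine .inl ⟨C :: cs, by simp [hcs], by simpa [hC] using hmem,
          List.pairwise_cons.2 ⟨fun C' hC' l hl l' hl' he => hCv l hl ?_, hdisj⟩⟩
        exact List.mem_map.2 ⟨l', List.mem_flatten.2 ⟨C', hC', hl'⟩, he.symm⟩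
    · exact .inr ⟨vs, hvs.trans (by rw [Nat.mul_succ]; omega), h⟩

end Val

end LitCNF

/-! ### The uniform depth. -/

namespace LitCNF

theorem exists_pow_bound (N : ℕ) : ∃ t, N * 3 ^ t ≤ 4 ^ t := by
  obtain ⟨t, ht⟩ := pow_unbounded_of_one_lt (N : ℚ) (show (1 : ℚ) < 4 / 3 by norm_num)
  refine ⟨t, ?_⟩
  rw [div_pow, lt_div_iff₀ (by positivity)] at ht
  exact_mod_cast ht.le

theorem count_nil {ν : Type} [Fintype ν] [DecidableEq ν] :
    count ([] : Formula ν) = 2 ^ Fintype.card ν := by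
  simp [count, Sat]

/-- `C` is a depth at which decision trees certify every weighted bound for the numbers of
satisfying assignments of formulas with the widths `m` and weights at most `W`. -/
def Certifies (m : Multiset ℕ) (W C : ℕ) : Prop :=
  ∀ (ν : Type) [Fintype ν] [DecidableEq ν] (L : Multiset (ℕ × ℕ × Formula ν)),
    L.map Prod.fst = m → (∀ x ∈ L, x.2.1 ≤ W ∧ Width x.1 x.2.2 ∧ Nontaut x.2.2) →
    ∀ θ, (L.map fun x => x.2.1 * count x.2.2).sum ≤ θ * 2 ^ Fintype.card ν →
      (L.map fun x => x.2.1 * val C x.2.2).sum ≤ θ * 2 ^ C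

section

variable {ν : Type} [DecidableEq ν]

theorem sum_val_add_le (L : Multiset (ℕ × ℕ × Formula ν)) (C d : ℕ) :
    (L.map fun x => x.2.1 * val (C + d) x.2.2).sum ≤
      2 ^ d * (L.map fun x => x.2.1 * val C x.2.2).sum := by
  rw [← Multiset.sum_map_mul_left]
  refine Multiset.sum_map_le_sum_map _ _ fun x _ => ?_
  rw [mul_left_comm]
  exact Nat.mul_le_mul_left _ (val_add_le C d x.2.2)

theorem sum_val_le_of_le {L : Multiset (ℕ × ℕ × Formula ν)} {θ C C' : ℕ} (hC : C ≤ C')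
    (h : (L.map fun x => x.2.1 * val C x.2.2).sum ≤ θ * 2 ^ C) :
    (L.map fun x => x.2.1 * val C' x.2.2).sum ≤ θ * 2 ^ C' := by
  obtain ⟨d, rfl⟩ := Nat.exists_eq_add_of_le hC
  refine (sum_val_add_le L C d).trans ((Nat.mul_le_mul_left _ h).trans (le_of_eq ?_))
  ring

end

/-- A formula with a small hitting set is replaced by `2 ^ r` narrower ones, while the other weights
and `θ` are multiplied by `2 ^ r`. The widths decrease in the multiset order, and the new weights
are bounded in terms of `W` and `r` alone, so the depth does not depend on the formulas. -/
theorem exists_certifies (m : Multiset ℕ) : (∀ k ∈ m, k ≤ 2) → ∀ W, ∃ C, Certifies m W C := by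
  -- In this order, one width is replaced by any finite number of smaller ones.
  induction m using (wellFounded_lt (α := ℕ)).cutExpand.induction with
  | _ m ih =>
  intro hm W
  -- With `t` disjoint clauses in each formula, the weighted sum at depth `2 * t` is at most `m.card
  -- * W * 3 ^ t`, which must not exceed `4 ^ t`.
  obtain ⟨t, ht⟩ := exists_pow_bound (m.card * W)
  have hex : ∀ k r, ∃ C, k ∈ m → Certifies (m.erase k +
      if k = 0 then 0 else Multiset.replicate (2 ^ r) (k - 1)) (2 ^ r * W) C := by
    intro k r
    by_cases hk : k ∈ m
    · obtain ⟨C, hC⟩ := ih (m.erase k + if k = 0 then 0 else Multiset.replicate (2 ^ r) (k - 1))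
        ⟨if k = 0 then 0 else Multiset.replicate (2 ^ r) (k - 1), k, fun a ha => by
          split at ha
          · simp at ha
          · have := Multiset.eq_of_mem_replicate ha
            omega, by
          conv_rhs => rw [← Multiset.cons_erase hk]
          rw [← Multiset.singleton_add]
          abel⟩
        (fun a ha => by
          rcases Multiset.mem_add.1 ha with ha | ha
          · exact hm a (Multiset.mem_of_mem_erase ha)
          · split at ha
            · simp at ha
            · have := Multiset.eq_of_mem_replicate ha
              have := hm k hk
              omega) (2 ^ r * W)
      exact ⟨C, fun _ => hC⟩
    · exact ⟨0, fun h => absurd h hk⟩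
  choose Cf hCf using hex
  -- Large enough for the one query of the case `θ = 0`, for the `2 * t` levels of disjoint clauses,
  -- and for every recursive depth preceded by `r` questions.
  let C := 2 * t + 1 + ∑ k ∈ Finset.range 3, ∑ r ∈ Finset.range (2 * t + 1), (Cf k r + r)
  have hCle : ∀ k ≤ 2, ∀ r ≤ 2 * t, Cf k r + r ≤ C := by
    intro k hk r hr
    have h1 : Cf k r + r ≤ ∑ r ∈ Finset.range (2 * t + 1), (Cf k r + r) :=
      Finset.single_le_sum (f := fun r => Cf k r + r) (fun _ _ => Nat.zero_le _)
        (Finset.mem_range.2 (by omega))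
    have h2 := Finset.single_le_sum
      (f := fun k => ∑ r ∈ Finset.range (2 * t + 1), (Cf k r + r)) (fun _ _ => Nat.zero_le _)
      (Finset.mem_range.2 (show k < 3 by omega))
    omega
  refine ⟨C, fun ν _ _ L hLm hL θ hθ => ?_⟩
  have hk2 : ∀ x ∈ L, x.1 ≤ 2 := fun x hx => hm _ (hLm ▸ Multiset.mem_map_of_mem _ hx)
  -- If `θ = 0`, every formula has weight 0 or is unsatisfiable.
  rcases Nat.eq_zero_or_pos θ with rfl | hpos
  · rw [zero_mul, Nat.le_zero, Multiset.sum_eq_zero_iff] at hθ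
    rw [zero_mul, Nat.le_zero, Multiset.sum_eq_zero_iff]
    intro y hy
    obtain ⟨x, hx, rfl⟩ := Multiset.mem_map.1 hy
    rcases Nat.mul_eq_zero.1 (hθ _ (Multiset.mem_map_of_mem _ hx)) with h | h
    · rw [h, zero_mul]
    · have hunsat : ∀ a, ¬Sat a x.2.2 := fun a ha =>
        Finset.filter_eq_empty_iff.1 (Finset.card_eq_zero.1 h) (Finset.mem_univ a) ha
      have h1 := val_one_eq_zero (fun K hK => ((hL x hx).2.1 K hK).trans (hk2 x hx)) hunsat
      have h2 := val_add_le 1 (C - 1) x.2.2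
      rw [h1, mul_zero, Nat.le_zero, show 1 + (C - 1) = C by omega] at h2
      rw [h2, mul_zero]
  by_cases hall : ∀ x ∈ L, ∃ cs, cs.length = t ∧ DisjointClauses x.2.2 cs
  · refine sum_val_le_of_le (C := 2 * t) (by omega) ?_
    have hle : ∀ y ∈ L.map (fun x => x.2.1 * val (2 * t) x.2.2), y ≤ W * 3 ^ t := by
      intro y hy
      obtain ⟨x, hx, rfl⟩ := Multiset.mem_map.1 hy
      obtain ⟨cs, hcs, hd⟩ := hall x hx
      have := hd.val_le (k := 2) (fun K hK => ((hL x hx).2.1 K hK).trans (hk2 x hx)) (hL x hx).2.2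
      rw [hcs] at this
      exact Nat.mul_le_mul (hL x hx).1 this
    refine (Multiset.sum_le_card_nsmul _ _ hle).trans ?_
    rw [Multiset.card_map, smul_eq_mul, ← mul_assoc, pow_mul]
    have hcard : L.card = m.card := by rw [← hLm, Multiset.card_map]
    rw [hcard]
    exact ht.trans (Nat.le_mul_of_pos_left _ hpos)
  · push Not at hall
    obtain ⟨⟨k, w, F⟩, hx, hno⟩ := hall
    obtain ⟨hw, hwid, hnt⟩ := hL _ hx
    have hk := hk2 _ hx
    simp only at hw hwid hnt hk hno
    obtain ⟨L', rfl⟩ := Multiset.exists_cons_of_mem hx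
    have hkm : k ∈ m := by rw [← hLm]; simp
    have herase : L'.map Prod.fst = m.erase k := by rw [← hLm]; simp
    simp only [Multiset.map_cons, Multiset.sum_cons] at hθ ⊢
    have hL' : ∀ x ∈ L', x.2.1 ≤ W ∧ Width x.1 x.2.2 ∧ Nontaut x.2.2 :=
      fun x hx => hL x (Multiset.mem_cons_of_mem hx)
    obtain ⟨vs, hvs, hhit⟩ := (exists_disjointClauses_or_hitting hwid t).resolve_left
      fun ⟨cs, hcs, hd⟩ => hno cs hcs hd
    have hr : vs.length ≤ 2 * t := hvs.trans (Nat.mul_le_mul_right _ hk)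
    have goal_cons : ∀ C, (((k, w, F) ::ₘ L').map fun x => x.2.1 * val C x.2.2).sum =
        w * val C F + (L'.map fun x => x.2.1 * val C x.2.2).sum := fun C => by simp
    rw [← goal_cons]
    -- A formula of width 0 that can be hit has no clauses, hence density 1. Its weight is
    -- subtracted from `θ`.
    rcases Nat.eq_zero_or_pos k with rfl | hkpos
    · have hF : F = [] := by
        refine List.eq_nil_iff_forall_not_mem.2 fun K hK => ?_
        obtain ⟨l, hl, -⟩ := hhit K hK
        have := List.length_pos_of_mem hl
        have := hwid K hK
        omega
      subst hF
      rw [count_nil] at hθ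
      have hwθ : w ≤ θ := by
        have : w * 2 ^ Fintype.card ν ≤ θ * 2 ^ Fintype.card ν := le_trans (Nat.le_add_right _ _) hθ
        exact Nat.le_of_mul_le_mul_right this (by positivity)
      have h1 := hCf 0 0 hkm ν L' (by simpa using herase) (by simpa using hL') (θ - w) (by
        rw [Nat.sub_mul]; omega)
      refine sum_val_le_of_le (C := Cf 0 0) (le_trans (by omega) (hCle 0 (by omega) 0 (by omega))) ?_
      rw [goal_cons]
      have h2 := Nat.mul_le_mul_left w (val_le_pow (Cf 0 0) ([] : Formula ν))
      have h3 := Nat.mul_le_mul_right (2 ^ Cf 0 0) hwθ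
      rw [Nat.sub_mul] at h1
      omega
    · set r := vs.length with hrdef
      let L'' : Multiset (ℕ × ℕ × Formula ν) := L'.map (fun x => (x.1, 2 ^ r * x.2.1, x.2.2)) +
        ((expand F vs : List _) : Multiset _).map fun G => (k - 1, w, G)
      have hcnt : (L''.map fun x => x.2.1 * count x.2.2).sum =
          2 ^ r * (L'.map fun x => x.2.1 * count x.2.2).sum + w * (2 ^ r * count F) := by
        simp only [L'', Multiset.map_add, Multiset.sum_add, Multiset.map_map, Function.comp_def,
          mul_assoc]
        rw [Multiset.sum_map_mul_left, Multiset.sum_map_mul_left, Multiset.map_coe,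
          Multiset.sum_coe]
        rw [sum_count_expand]
      have hval : ∀ C, (L''.map fun x => x.2.1 * val C x.2.2).sum =
          2 ^ r * (L'.map fun x => x.2.1 * val C x.2.2).sum +
            w * ((expand F vs).map (val C)).sum := by
        intro C
        simp only [L'', Multiset.map_add, Multiset.sum_add, Multiset.map_map, Function.comp_def,
          mul_assoc]
        rw [Multiset.sum_map_mul_left, Multiset.sum_map_mul_left, Multiset.map_coe,
          Multiset.sum_coe]
      have h1 := hCf k r hkm ν L'' (by
          rw [if_neg (by omega)]
          simp only [L'', Multiset.map_add, Multiset.map_map, Function.comp_def,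
            Multiset.map_const', Multiset.coe_card, length_expand, herase]
          rw [← hrdef]) (by
          intro x hx
          rcases Multiset.mem_add.1 hx with hx | hx
          · obtain ⟨y, hy, rfl⟩ := Multiset.mem_map.1 hx
            exact ⟨Nat.mul_le_mul_left _ (hL' y hy).1, (hL' y hy).2⟩
          · obtain ⟨G, hG, rfl⟩ := Multiset.mem_map.1 hx
            refine ⟨hw.trans (Nat.le_mul_of_pos_left _ (by positivity)), ?_, hnt.expand vs G hG⟩
            exact width_expand vs (fun K hK => .inr ⟨(hwid K hK).trans (by omega), hhit K hK⟩) G hG)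
        (2 ^ r * θ) (by
          rw [hcnt, mul_assoc, mul_left_comm w, ← mul_add]
          refine Nat.mul_le_mul_left _ ?_
          omega)
      rw [hval] at h1
      refine sum_val_le_of_le (hCle k hk r hr) ?_
      rw [goal_cons]
      have h2 := Nat.mul_le_mul_left w (val_le_sum_expand (Cf k r) F vs)
      have h3 := sum_val_add_le L' (Cf k r) r
      have h4 : θ * 2 ^ (Cf k r + r) = 2 ^ r * θ * 2 ^ Cf k r := by ring
      rw [h4]
      rw [← hrdef] at h2
      omega

/-- Decision trees of bounded depth certify that at most half of the assignments satisfy a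
3-CNF. -/
theorem exists_depth : ∃ C, ∀ (ν : Type) [Fintype ν] [DecidableEq ν] (F : Formula ν), Width 3 F →
    Nontaut F → (2 * count F ≤ 2 ^ Fintype.card ν ↔ 2 * val C F ≤ 2 ^ C) := by
  -- Weight 2 expresses the bound one half with a natural `θ`: over the `2 ^ r` leaves, `2 * count`
  -- sums to at most `2 ^ r * 2 ^ n`.
  have hex : ∀ r, ∃ C, Certifies (Multiset.replicate (2 ^ r) 2) 2 C := fun r =>
    exists_certifies _ (fun k hk => (Multiset.eq_of_mem_replicate hk).le) 2
  choose Cf hCf using hex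
  let C := 18 + ∑ r ∈ Finset.range 19, (Cf r + r)
  have hCle : ∀ r ≤ 18, Cf r + r ≤ C := fun r hr => by
    have := Finset.single_le_sum (f := fun r => Cf r + r) (fun _ _ => Nat.zero_le _)
      (Finset.mem_range.2 (show r < 19 by omega))
    omega
  refine ⟨C, fun ν _ _ F hF hnt => ⟨fun h => ?_, fun h => ?_⟩⟩
  · have lift : ∀ C' ≤ C, 2 * val C' F ≤ 2 ^ C' → 2 * val C F ≤ 2 ^ C := by
      intro C' hC' h'
      have := sum_val_le_of_le (L := {(0, 2, F)}) (θ := 1) hC' (by simpa using h')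
      simpa using this
    -- Six clauses suffice as `7 ^ 6 = 117649 ≤ 2 ^ 17`; a hitting set has at most `3 * 6 = 18`
    -- variables.
    rcases exists_disjointClauses_or_hitting hF 6 with ⟨cs, hcs, hd⟩ | ⟨vs, hvs, hhit⟩
    · have := hd.val_le hF hnt
      rw [hcs] at this
      exact lift 18 (by omega) (by norm_num at this ⊢; omega)
    · have h1 := hCf vs.length ν (((expand F vs : List _) : Multiset _).map fun G => (2, 2, G))
        (by simp only [Multiset.map_map, Function.comp_def, Multiset.map_const', Multiset.coe_card,
          length_expand]) (by
          intro x hx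
          obtain ⟨G, hG, rfl⟩ := Multiset.mem_map.1 hx
          refine ⟨le_rfl, ?_, hnt.expand vs G hG⟩
          exact width_expand vs (fun K hK => .inr ⟨hF K hK, hhit K hK⟩) G hG) (2 ^ vs.length) (by
          simp only [Multiset.map_map, Function.comp_def]
          rw [Multiset.sum_map_mul_left, Multiset.map_coe, Multiset.sum_coe, sum_count_expand,
            mul_left_comm]
          exact Nat.mul_le_mul_left _ h)
      simp only [Multiset.map_map, Function.comp_def] at h1
      rw [Multiset.sum_map_mul_left, Multiset.map_coe, Multiset.sum_coe] at h1
      refine lift _ (hCle vs.length (by omega)) ?_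
      have h2 := val_le_sum_expand (Cf vs.length) F vs
      rw [pow_add, mul_comm (2 ^ Cf vs.length)]
      omega
  · have h1 := two_pow_mul_count_le C F
    have h2 := Nat.mul_le_mul_right (2 ^ Fintype.card ν) h
    have h3 : 2 ^ C * (2 * count F) ≤ 2 ^ C * 2 ^ Fintype.card ν := by
      refine le_trans ?_ h2
      rw [mul_left_comm, mul_assoc]
      exact Nat.mul_le_mul_left _ h1
    exact Nat.le_of_mul_le_mul_left h3 (by positivity)

end LitCNF

/-! ### Input and output of the machine. -/

namespace StackProg

/-- Push the representation of the stored symbol, if it is in the list. -/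
def pushCode : List Γ' → Prog
  | [] => load none
  | x :: l => .ite (isSym x) (pushStr (str x)) (pushCode l)

theorem length_str_sym (x : Γ') : (str x).length ≤ 11 := by
  rcases x with _ | (_ | _) | _ | _ | _ <;> decide

theorem exec_pushCode {x : Γ'} {l : List Γ'} (hx : x ∈ l) {i m a c} :
    Exec (pushCode l) (some x) (mk i m a c) none (mk i (str x ++ m) a c) (12 + l.length) := by
  induction l with
  | nil => simp at hx
  | cons y l ih =>
    by_cases hxy : y = x
    · subst hxy
      have := length_str_sym y
      refine Exec.mono (Exec.ite_true (by simp [isSym]) (exec_pushStr _)) ?_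
      rw [List.length_cons]
      omega
    · refine Exec.mono (Exec.ite_false (by simp [isSym, Ne.symm hxy])
        (ih ((List.mem_cons.1 hx).resolve_left (Ne.symm hxy)))) ?_
      rw [List.length_cons]
      omega

/-- Read one symbol of the input. -/
def readInp : Prog := .pop .inp fun _ x => x

/-- The symbols of the input alphabet. -/
def symbols : List Γ' := [.blank, .bit false, .bit true, .bra, .ket, .comma]

theorem mem_symbols (x : Γ') : x ∈ symbols := by
  rcases x with _ | (_ | _) | _ | _ | _ <;> simp [symbols]

/-- Put the stored symbol in front of the list on the value stack and read the next one. -/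
def readBody : Prog := .seq (pushCode symbols) (.seq (pushSym (.bit true)) readInp)

/-- Read the input as a list in reverse order. -/
def readAll : Prog :=
  .seq (pushStr [.bit false]) (.seq readInp (.loop Option.isSome readBody))

theorem exec_readLoop (l : List Γ') : ∀ acc : List Γ',
    Exec (.loop Option.isSome readBody) l.head? (mk l.tail (str acc) [] []) none
      (mk [] (str (l.reverse ++ acc)) [] []) (21 * l.length + 1) := by
  induction l with
  | nil => exact fun acc => Exec.loop_false rfl
  | cons x l ih =>
    intro acc
    have h := ih (x :: acc)
    rw [List.reverse_cons, List.append_assoc]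
    exact Exec.mono (Exec.loop_true rfl (Exec.seq (exec_pushCode (mem_symbols x))
      (Exec.seq Exec.pushMain Exec.popInp)) h) (by simp [symbols]; omega)

theorem exec_readAll (w : List Γ') :
    Exec readAll none (mk w [] [] []) none (mk [] (str w.reverse) [] []) (21 * w.length + 4) := by
  have h := exec_readLoop w []
  rw [List.append_nil] at h
  exact Exec.mono (Exec.seq (exec_pushStr [.bit false]) (Exec.seq Exec.popInp h))
    (by simp; omega)

/-- Write the truth value on the value stack to the output. -/
def writeBool : Prog :=
  .seq readSym (.ite (isSym (.bit true))
    (.seq popSym (.seq popSym (.push .out fun _ => true)))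
    (.seq (load none) (.push .out fun _ => false)))

theorem exec_writeBool (b : Bool) :
    Exec writeBool none (mk [] (str b) [] []) none
      (Function.update (mk [] [] [] []) .out [b]) 5 := by
  cases b
  · exact Exec.mono (Exec.seq Exec.popMain (Exec.ite_false (by rfl) (Exec.seq Exec.load
      Exec.push))) (by omega)
  · exact Exec.mono (Exec.seq Exec.popMain (Exec.ite_true (by rfl) (Exec.seq Exec.popMain
      (Exec.seq Exec.popMain Exec.push)))) (by omega)

theorem size_list_sym (w : List Γ') : size w ≤ 12 * w.length + 1 := by
  induction w with
  | nil => simp [size_nil]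
  | cons x w ih =>
    have : size x ≤ 11 := length_str_sym x
    rw [size_cons, List.length_cons]
    omega

/-- Languages that are decided in polynomial time by structured programs are in `P`. -/
theorem inP_of_polyDec {L : Language Γ'} (hL : PolyDec fun w : List Γ' => w ∈ L) : InP L := by
  obtain ⟨c, hc, hc'⟩ := hL
  -- Reading stacks the input up in reverse order, so the program starts by reversing it.
  obtain ⟨p, T, ⟨P, hP⟩, -, hr⟩ := hc.comp (Poly.id (α := List Γ')).reverse
  refine inP_of_exec (.seq readAll (.seq p writeBool))
    (21 * Polynomial.X + 4 + (P.comp (12 * Polynomial.X + 1) + 5)) fun w => ⟨c w, hc' w, ?_⟩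
  have h := hr w.reverse [] []
  simp only [List.append_nil, List.reverse_reverse] at h
  refine Exec.mono (Exec.seq (exec_readAll w) (Exec.seq h (exec_writeBool _))) ?_
  have h1 := hP w.reverse
  have h2 : P.eval (size w.reverse) ≤ P.eval (12 * w.length + 1) := by
    refine eval_le_eval_of_le P ?_
    have := size_list_sym w.reverse
    rwa [List.length_reverse] at this
  simp only [Polynomial.eval_add, Polynomial.eval_mul, Polynomial.eval_comp, Polynomial.eval_X,
    Polynomial.eval_ofNat, Polynomial.eval_one]
  omega

end StackProg

/-! ### Invariance under renaming of variables. -/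

namespace LitCNF

section Rename

variable {ν μ : Type}

/-- Rename the variable of a literal. -/
def renameLit (g : ν → μ) (l : Bool × ν) : Bool × μ := (l.1, g l.2)

/-- Rename the variables of a formula. -/
def rename (g : ν → μ) (F : Formula ν) : Formula μ := F.map (List.map (renameLit g))

theorem renameLit_injective {g : ν → μ} (hg : Function.Injective g) :
    Function.Injective (renameLit g) := by
  rintro ⟨b, v⟩ ⟨c, w⟩ h
  simp only [renameLit, Prod.mk.injEq] at h
  rw [h.1, hg h.2]

theorem flatten_rename (g : ν → μ) (F : Formula ν) :
    (rename g F).flatten = F.flatten.map (renameLit g) := by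
  rw [rename, ← List.map_flatten]

theorem neg_renameLit (g : ν → μ) (l : Bool × ν) : neg (renameLit g l) = renameLit g (neg l) := rfl

variable [DecidableEq ν] [DecidableEq μ] {g : ν → μ} (hg : Function.Injective g)
include hg

theorem restrict_rename (F : Formula ν) (v : ν) (b : Bool) :
    restrict (rename g F) (g v) b = rename g (restrict F v b) := by
  have hinj := renameLit_injective hg
  have h1 : ∀ c (C : List (Bool × ν)), (c, g v) ∈ C.map (renameLit g) ↔ (c, v) ∈ C := fun c C =>
    List.mem_map_of_injective hinj (a := (c, v))
  have h2 : ∀ (l : Bool × ν), renameLit g l = (!b, g v) ↔ l = (!b, v) := fun l =>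
    hinj.eq_iff (b := (!b, v))
  simp only [restrict, rename, List.filter_map, List.map_map, Function.comp_def, h1, h2]

theorem upStep_rename (F : Formula ν) (D : List (Bool × ν)) :
    upStep (rename g F) (D.map (renameLit g)) = (upStep F D).map (renameLit g) := by
  have hinj := renameLit_injective hg
  rw [upStep, upStep, flatten_rename, List.filter_map]
  congr 1
  refine List.filter_congr fun l _ => ?_
  simp only [Function.comp_apply, decide_eq_decide]
  simp only [rename, List.mem_map, exists_exists_and_eq_and, forall_exists_index, and_imp,
    forall_apply_eq_imp_iff₂, neg_renameLit, hinj.eq_iff, exists_eq_right]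

theorem refuted_rename (F : Formula ν) : Refuted (rename g F) ↔ Refuted F := by
  have hinj := renameLit_injective hg
  have h : upClosure (rename g F) = (upClosure F).map (renameLit g) := by
    rw [upClosure_eq, upClosure_eq, flatten_rename, List.length_map]
    generalize F.flatten.length = i
    induction i with
    | zero => rfl
    | succ i ih => rw [Function.iterate_succ_apply', Function.iterate_succ_apply', ih,
        upStep_rename hg]
  rw [Refuted, h]
  simp only [rename, List.mem_map, exists_exists_and_eq_and, forall_exists_index, and_imp,
    forall_apply_eq_imp_iff₂, neg_renameLit, hinj.eq_iff, exists_eq_right]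
  rfl

/-- Restriction and unit propagation only compare variables for equality. So `val` may be computed
with binary strings as variables. -/
theorem val_rename (j : ℕ) (F : Formula ν) : val j (rename g F) = val j F := by
  induction j generalizing F with
  | zero => simp only [val, refuted_rename hg]
  | succ j ih =>
    rw [val, val, flatten_rename, List.foldr_map]
    simp only [renameLit, restrict_rename hg, ih]

end Rename

end LitCNF

/-! ### Comparing `val` with a constant in polynomial time. -/

namespace StackProg

open LitCNF

variable {α ν : Type} [Enc α] [Enc ν] [DecidableEq ν] [PolyEq ν]

omit [DecidableEq ν] [PolyEq ν] in
theorem Poly.neg {f : α → Bool × ν} (hf : Poly f) : Poly fun a => neg (f a) :=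
  (((PolyDec.ofBool hf.fst).ite (.const false) (.const true)).congr
    (g := fun a => !(f a).1) fun a => by cases (f a).1 <;> rfl).pair hf.snd

theorem Poly.restrict {F : α → Formula ν} {v : α → ν} (hF : Poly F) (hv : Poly v) (b : Bool) :
    Poly fun a => restrict (F a) (v a) b := by
  have h1 := Poly.filter (P := fun a C => ¬(b, v a) ∈ C) hF
    (PolyDec.mem ((Poly.const b).pair (hv.comp Poly.id.fst)) Poly.id.snd).not
  have h2 := Poly.filter (P := fun (p : α × List (Bool × ν)) l => ¬l = (!b, v p.1)) Poly.id.snd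
    (PolyDec.eq Poly.id.snd ((Poly.const (!b)).pair (hv.comp Poly.id.fst.fst))).not
  exact Poly.map (f := fun a C => C.filter fun l => decide (¬l = (!b, v a))) h1 h2

theorem Poly.upStep {F : α → Formula ν} {D : α → List (Bool × ν)} (hF : Poly F) (hD : Poly D) :
    Poly fun a => upStep (F a) (D a) :=
  Poly.filter (P := fun a l => ∃ C ∈ F a, l ∈ C ∧ ∀ l' ∈ C, l' = l ∨ LitCNF.neg l' ∈ D a) hF.flatten
    (PolyDec.bex (P := fun (p : α × Bool × ν) C => p.2 ∈ C ∧ ∀ l' ∈ C, l' = p.2 ∨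
        LitCNF.neg l' ∈ D p.1)
      ((PolyDec.mem Poly.id.fst.snd Poly.id.snd).and
        (PolyDec.ball (P := fun (q : (α × Bool × ν) × List (Bool × ν)) l' => l' = q.1.2 ∨
            LitCNF.neg l' ∈ D q.1.1)
          ((PolyDec.eq Poly.id.snd Poly.id.fst.fst.snd).or
            (PolyDec.mem Poly.id.snd.neg (hD.comp Poly.id.fst.fst.fst))) Poly.id.snd))
      (hF.comp Poly.id.fst))

theorem Poly.upClosure : Poly fun F : Formula ν => upClosure F :=
  Poly.foldl (h := fun F : Formula ν => F.flatten) (i := fun _ => []) (f := fun F _ =>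
    LitCNF.upStep F) (g := fun F => size F.flatten) Poly.id.flatten (.const [])
    (Poly.upStep Poly.id.fst Poly.id.snd.snd) Poly.id.flatten.size_le fun _ _ _ _ =>
      (size_le_of_sublist List.filter_sublist).trans (Nat.le_add_left _ _)

theorem PolyDec.refuted : PolyDec fun F : Formula ν => Refuted F :=
  PolyDec.bex (P := fun (F : Formula ν) C => ∀ l ∈ C, LitCNF.neg l ∈ LitCNF.upClosure F)
    (PolyDec.ball (P := fun (p : Formula ν × List (Bool × ν)) l =>
        LitCNF.neg l ∈ LitCNF.upClosure p.1)
      (PolyDec.mem Poly.id.snd.neg (Poly.upClosure.comp Poly.id.fst.fst)) Poly.id.snd) Poly.id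

/-- Since `j` and `s` are constants, each level adds one search through the literals and finitely
many tests of the level below. -/
theorem PolyDec.val_le (j s : ℕ) : PolyDec fun F : Formula ν => val j F ≤ s := by
  induction j generalizing s with
  | zero =>
    rcases Nat.eq_zero_or_pos s with rfl | hs
    · exact PolyDec.refuted.congr fun F => by simp [val]
    · refine (PolyDec.const True).congr fun F => iff_true_intro ?_
      rw [val]
      split <;> omega
  | succ j ih =>
    -- A sum is at most `s` if and only if the summands are at most `i` and `s - i` for some `i ≤
    -- s`. This avoids computing `val` and adding numbers.
    have hsum : PolyDec fun p : Formula ν × Bool × ν => ∃ i ∈ Finset.range (s + 1),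
        val j (LitCNF.restrict p.1 p.2.2 true) ≤ i ∧
          val j (LitCNF.restrict p.1 p.2.2 false) ≤ s - i :=
      PolyDec.finite_ex _ fun i => ((ih i).comp (Poly.id.fst.restrict Poly.id.snd.snd true)).and
        ((ih (s - i)).comp (Poly.id.fst.restrict Poly.id.snd.snd false))
    refine ((ih (s / 2)).or (PolyDec.bex (P := fun (F : Formula ν) (l : Bool × ν) =>
      ∃ i ∈ Finset.range (s + 1), val j (LitCNF.restrict F l.2 true) ≤ i ∧
        val j (LitCNF.restrict F l.2 false) ≤ s - i) hsum Poly.id.flatten)).congr fun F => ?_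
    rw [val_succ_le_iff, Nat.le_div_iff_mul_le two_pos, mul_comm]
    refine or_congr_right (exists_congr fun l => and_congr_right fun _ => ⟨fun h => ?_, ?_⟩)
    · exact ⟨_, Finset.mem_range.2 (by omega), le_rfl, by omega⟩
    · rintro ⟨i, hi, h1, h2⟩
      have := Finset.mem_range.1 hi
      omega

theorem Poly.filterNontaut : Poly fun F : Formula ν =>
    F.filter fun C => decide (∀ l ∈ C, LitCNF.neg l ∉ C) :=
  Poly.filter (P := fun (_ : Formula ν) C => ∀ l ∈ C, LitCNF.neg l ∉ C) Poly.id
    (PolyDec.ball (P := fun (p : Formula ν × List (Bool × ν)) l => LitCNF.neg l ∉ p.2)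
      (PolyDec.mem Poly.id.snd.neg Poly.id.fst.snd).not Poly.id.snd)

end StackProg

/-! ### Binary numbers. -/

namespace Bits

/-- The number with the given binary digits, least significant digit first. -/
def value : List Bool → ℕ
  | [] => 0
  | b :: l => (if b then 1 else 0) + 2 * value l

/-- There are no superfluous zeros. -/
def Canonical (l : List Bool) : Prop := l.foldl (fun _ b => b) true = true

theorem canonical_cons {b : Bool} {l : List Bool} :
    Canonical (b :: l) ↔ (l = [] ∧ b = true) ∨ (l ≠ [] ∧ Canonical l) := by
  cases l <;> simp [Canonical]

theorem value_encodePosNum (p : PosNum) : value (encodePosNum p) = p := by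
  induction p with
  | one => rfl
  | bit0 p ih => simp [encodePosNum, value, ih, PosNum.cast_bit0, two_mul]
  | bit1 p ih => simp [encodePosNum, value, ih, PosNum.cast_bit1]; omega

theorem canonical_encodePosNum (p : PosNum) : Canonical (encodePosNum p) := by
  induction p with
  | one => rfl
  | bit0 p ih => exact canonical_cons.2 (.inr ⟨encodePosNum_nonempty p, ih⟩)
  | bit1 p ih => exact canonical_cons.2 (.inr ⟨encodePosNum_nonempty p, ih⟩)

theorem value_encodeNat (n : ℕ) : value (encodeNat n) = n := by
  have h : ∀ m : Num, value (encodeNum m) = m := by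
    rintro (_ | p)
    · rfl
    · exact value_encodePosNum p
  rw [encodeNat, h, Num.to_of_nat]

theorem canonical_encodeNat (n : ℕ) : Canonical (encodeNat n) := by
  have h : ∀ m : Num, Canonical (encodeNum m) := by
    rintro (_ | p)
    · rfl
    · exact canonical_encodePosNum p
  exact h _

theorem eq_nil_of_value_eq_zero {l : List Bool} (h : Canonical l) (h0 : value l = 0) : l = [] := by
  induction l with
  | nil => rfl
  | cons b l ih =>
    rw [value] at h0
    rcases canonical_cons.1 h with ⟨-, rfl⟩ | ⟨hl, hc⟩
    · simp at h0
    · exact absurd (ih hc (by omega)) hl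

theorem value_injOn {l l' : List Bool} (h : Canonical l) (h' : Canonical l')
    (he : value l = value l') : l = l' := by
  have tail : ∀ {b l}, Canonical (b :: l) → Canonical l := by
    intro b l h
    rcases canonical_cons.1 h with ⟨rfl, -⟩ | ⟨-, h⟩
    · rfl
    · exact h
  induction l generalizing l' with
  | nil => exact (eq_nil_of_value_eq_zero h' he.symm).symm
  | cons b l ih =>
    cases l' with
    | nil => exact eq_nil_of_value_eq_zero h he
    | cons b' l' =>
      simp only [value] at he
      have h1 : value l = value l' ∧ b = b' := by
        cases b <;> cases b' <;> simp at he ⊢ <;> omega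
      rw [h1.2, ih (tail h) (tail h') h1.1]

theorem encodeNat_value {l : List Bool} (h : Canonical l) : encodeNat (value l) = l :=
  value_injOn (canonical_encodeNat _) h (value_encodeNat _)

/-- One step of the comparison of two binary numbers: the second one loses a digit, and the truth
value tells whether the low part of the first number is smaller. -/
def ltStep (a : Bool) (s : List Bool × Bool) : List Bool × Bool :=
  match s.1 with
  | [] => ([], if a then false else s.2)
  | b :: r => (r, if a = b then s.2 else b)

/-- Comparison of binary numbers. -/
def Lt (l r : List Bool) : Prop :=
  (l.foldl (fun s a => ltStep a s) (r, false)).2 = true ∨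
    true ∈ (l.foldl (fun s a => ltStep a s) (r, false)).1

theorem true_mem_iff {r : List Bool} : true ∈ r ↔ 0 < value r := by
  induction r with
  | nil => simp [value]
  | cons b r ih => cases b <;> simp [value, ih]

theorem lt_iff {l r : List Bool} : Lt l r ↔ value l < value r := by
  -- The initial flag `c` stands for lower digits already compared: it decides only when the
  -- remaining numbers are equal.
  have key : ∀ (l r : List Bool) (c : Bool),
      ((l.foldl (fun s a => ltStep a s) (r, c)).2 = true ∨
        true ∈ (l.foldl (fun s a => ltStep a s) (r, c)).1) ↔
      value l < value r ∨ (value l = value r ∧ c = true) := by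
    intro l
    induction l with
    | nil =>
      intro r c
      simp only [List.foldl_nil, true_mem_iff, value]
      have : value r = 0 ∨ 0 < value r := by omega
      rcases this with h | h
      · simp [h]
      · simp [h]
    | cons a l ih =>
      intro r c
      rw [List.foldl_cons]
      cases r with
      | nil =>
        rw [ltStep, ih]
        cases a <;> cases c <;> simp [value]
      | cons b r =>
        rw [ltStep, ih]
        cases a <;> cases b <;> cases c <;> simp [value] <;> omega
  rw [Lt, key]
  simp

end Bits

/-! ### Parsing and validating the input. -/

namespace StackProg

open LitCNF Bits

theorem PolyDec.canonical {α : Type} [Enc α] {f : α → List Bool} (hf : Poly f) :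
    PolyDec fun a => Canonical (f a) := by
  have := Poly.foldl (f := fun _ b _ => b) (i := fun _ => true) (g := fun _ => 3) hf (.const _)
    Poly.id.snd.fst (.const 3) fun _ b _ _ => (size_bool b).trans (Nat.le_add_left _ _)
  exact .ofBool this

theorem PolyDec.lt {α : Type} [Enc α] {f g : α → List Bool} (hf : Poly f) (hg : Poly g) :
    PolyDec fun a => Lt (f a) (g a) := by
  have hstep : Poly fun p : α × Bool × (List Bool × Bool) => ltStep p.2.1 p.2.2 := by
    refine (Poly.listCases (h := fun p : α × Bool × (List Bool × Bool) => p.2.2.1)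
      (f := fun p => (([] : List Bool), if p.2.1 then false else p.2.2.2))
      (g := fun p b r => (r, if p.2.1 = b then p.2.2.2 else b)) Poly.id.snd.snd.fst
      ((Poly.const []).pair (Poly.id.snd.fst.cond (.const _) Poly.id.snd.snd.snd))
      (Poly.id.fst.snd.pair (PolyDec.ite
        (P := fun p : (Bool × List Bool) × α × Bool × (List Bool × Bool) => p.2.2.1 = p.1.1)
        (PolyDec.eq Poly.id.snd.snd.fst Poly.id.fst.fst) Poly.id.snd.snd.snd.snd
        Poly.id.fst.fst))).congr ?_
    rintro ⟨x, a, _ | ⟨b, r⟩, c⟩ <;> rfl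
  have := Poly.foldl (i := fun a => (g a, false)) (f := fun _ b s => ltStep b s) (g := fun _ => 5)
    hf (hg.pair (.const _)) hstep (.const 5) (fun p a _ s => by
      obtain ⟨r, k⟩ := s
      cases r with
      | nil =>
        have := size_bool (if a then false else k)
        simp only [ltStep, size_pair, size_nil]; omega
      | cons c r =>
        have := size_bool (if a = c then k else c)
        simp only [ltStep, size_pair, size_cons]; omega)
  exact (PolyDec.ofBool this.snd).or (PolyDec.mem (.const true) this.fst)

/-- A formula whose variables are given in binary, together with the number of variables. -/
abbrev Raw := List Bool × Formula (List Bool)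

/-- The string that represents a literal. -/
def encodeLit (l : Bool × List Bool) : List Γ' := .comma :: .bit l.1 :: l.2.map .bit

/-- The string that represents a clause. -/
def encodeClause (C : List (Bool × List Bool)) : List Γ' :=
  .bra :: (C.flatMap encodeLit ++ [.ket])

/-- The string that represents a formula. -/
def encodeRaw (r : Raw) : List Γ' := r.1.map .bit ++ r.2.flatMap encodeClause

/-- The parser reads the string from right to left and stores the digits of the current number,
the literals of the current clause and the clauses. -/
abbrev ParseState := List Bool × List (Bool × List Bool) × Formula (List Bool)

/-- One step of the parser. -/
def parseStep (x : Γ') (s : ParseState) : ParseState :=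
  if x = .comma then
    match s.1 with
    | [] => s
    | b :: l => ([], (b, l) :: s.2.1, s.2.2)
  else if x = .bra then (s.1, [], s.2.1 :: s.2.2)
  else if x = .ket then s
  else ((symCode x).2.1 :: s.1, s.2)

/-- The parser. -/
def parse (w : List Γ') : Raw :=
  let s := w.foldr parseStep ([], [], [])
  (s.1, s.2.2)

theorem foldr_parseStep_bits (l b : List Bool) (s) :
    (l.map Γ'.bit).foldr parseStep (b, s) = (l ++ b, s) := by
  induction l with
  | nil => rfl
  | cons a l ih => rw [List.map_cons, List.foldr_cons, ih]; simp [parseStep, symCode]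

/-- Read from right to left, the index and then the sign join the digits; the comma splits off the
head as the sign. -/
theorem foldr_parseStep_lits (C D : List (Bool × List Bool)) (F) :
    (C.flatMap encodeLit).foldr parseStep ([], D, F) = ([], C ++ D, F) := by
  induction C with
  | nil => rfl
  | cons l C ih =>
    rw [List.flatMap_cons, List.foldr_append, ih, encodeLit, List.foldr_cons, List.foldr_cons,
      foldr_parseStep_bits]
    simp [parseStep, symCode]

theorem foldr_parseStep_clauses (F : Formula (List Bool)) :
    (F.flatMap encodeClause).foldr parseStep ([], [], []) = ([], [], F) := by
  induction F with
  | nil => rfl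
  | cons C F ih =>
    rw [List.flatMap_cons, List.foldr_append, ih, encodeClause, List.foldr_cons, List.foldr_append]
    have : [Γ'.ket].foldr parseStep ([], [], F) = ([], [], F) := by simp [parseStep]
    rw [this, foldr_parseStep_lits]
    simp [parseStep]

/-- Hence `w` is the code of a raw formula exactly if `encodeRaw (parse w) = w`, and the behaviour
of the parser on malformed strings is irrelevant. -/
theorem parse_encodeRaw (r : Raw) : parse (encodeRaw r) = r := by
  simp [parse, encodeRaw, List.foldr_append, foldr_parseStep_clauses, foldr_parseStep_bits]

theorem Poly.encodeRaw : Poly encodeRaw := by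
  have hbits : Poly fun l : List Bool => l.map Γ'.bit := Poly.id.map Poly.id.snd.bit
  have hlit : Poly encodeLit :=
    (Poly.const Γ'.comma).cons (Poly.id.fst.bit.cons (hbits.comp Poly.id.snd))
  have hcl : Poly encodeClause :=
    (Poly.const Γ'.bra).cons ((Poly.id.flatMap (hlit.comp Poly.id.snd)).append (.const [Γ'.ket]))
  exact (hbits.comp Poly.id.fst).append (Poly.id.snd.flatMap (hcl.comp Poly.id.snd))

theorem size_parseStep_le (x : Γ') (s : ParseState) : size (parseStep x s) ≤ size s + 5 := by
  obtain ⟨b, C, F⟩ := s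
  rw [parseStep]
  split
  · cases b with
    | nil => exact Nat.le_add_right _ _
    | cons b l => simp only [size_pair, size_cons, size_nil]; omega
  split
  · simp only [size_pair, size_cons, size_nil]; omega
  split
  · exact Nat.le_add_right _ _
  · have := size_bool (symCode x).2.1
    simp only [size_pair, size_cons]; omega

theorem Poly.parse : Poly parse := by
  have hcomma : Poly fun p : List Γ' × Γ' × ParseState =>
      (match p.2.2.1 with
      | [] => p.2.2
      | b :: l => (([], (b, l) :: p.2.2.2.1, p.2.2.2.2) : ParseState)) := by
    refine (Poly.listCases (f := fun p : List Γ' × Γ' × ParseState => p.2.2)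
      (g := fun p b l => (([], (b, l) :: p.2.2.2.1, p.2.2.2.2) : ParseState)) Poly.id.snd.snd.fst
      Poly.id.snd.snd ((Poly.const []).pair ((Poly.id.fst.cons Poly.id.snd.snd.snd.snd.fst).pair
        Poly.id.snd.snd.snd.snd.snd))).congr ?_
    rintro ⟨x, y, _ | ⟨b, r⟩, c⟩ <;> rfl
  have hx : Poly fun p : List Γ' × Γ' × ParseState => p.2.1 := Poly.id.snd.fst
  have hs : Poly fun p : List Γ' × Γ' × ParseState => p.2.2 := Poly.id.snd.snd
  have hstep : Poly fun p : List Γ' × Γ' × ParseState => parseStep p.2.1 p.2.2 :=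
    PolyDec.ite (P := fun p : List Γ' × Γ' × ParseState => p.2.1 = .comma)
      (PolyDec.eq hx (.const _)) hcomma
      (PolyDec.ite (P := fun p : List Γ' × Γ' × ParseState => p.2.1 = .bra)
        (PolyDec.eq hx (.const _)) (hs.fst.pair ((Poly.const []).pair (hs.snd.fst.cons hs.snd.snd)))
        (PolyDec.ite (P := fun p : List Γ' × Γ' × ParseState => p.2.1 = .ket)
          (PolyDec.eq hx (.const _)) hs ((hx.symCode.snd.fst.cons hs.fst).pair hs.snd)))
  have := Poly.foldr (h := fun w : List Γ' => w) (i := fun _ => (([], [], []) : ParseState))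
    (f := fun _ => parseStep) (g := fun _ => 5) Poly.id (.const _) hstep (.const 5)
    fun _ x _ s => size_parseStep_le x s
  exact this.fst.pair this.snd.snd

/-- The formula with the variables written in binary. -/
def toRaw {n : ℕ} (F : CNF n) : Raw :=
  (encodeNat n, F.map (List.map fun l => (l.positive, encodeNat l.var)))

theorem encodeRaw_toRaw {n : ℕ} (F : CNF n) : encodeRaw (toRaw F) = CNF.encode F := by
  have h : ∀ C : Clause n, encodeClause (C.map fun l => (l.positive, encodeNat l.var)) =
      C.encode := fun C => by
    simp only [encodeClause, Clause.encode, List.flatMap_map]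
    rfl
  simp only [encodeRaw, toRaw, CNF.encode, binary, List.flatMap_map, h]

/-- The well-formed descriptions of `k`-CNF formulas. -/
def ValidRaw (k : ℕ) (r : Raw) : Prop :=
  Canonical r.1 ∧ ∀ C ∈ r.2, C.length ≤ k ∧ ∀ l ∈ C, Canonical l.2 ∧ Lt l.2 r.1

theorem PolyDec.validRaw (k : ℕ) : PolyDec (ValidRaw k) :=
  (PolyDec.canonical Poly.id.fst).and (PolyDec.ball
    (P := fun (r : Raw) C => C.length ≤ k ∧ ∀ l ∈ C, Canonical l.2 ∧ Lt l.2 r.1)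
    ((PolyDec.length_le Poly.id.snd k).and (PolyDec.ball
      (P := fun (p : Raw × List (Bool × List Bool)) l => Canonical l.2 ∧ Lt l.2 p.1.1)
      ((PolyDec.canonical Poly.id.snd.snd).and (PolyDec.lt Poly.id.snd.snd Poly.id.fst.fst.fst))
      Poly.id.snd)) Poly.id.snd)

theorem validRaw_iff {k : ℕ} {r : Raw} :
    ValidRaw k r ↔ ∃ (n : ℕ) (F : CNF n), CNF.IsKCNF k F ∧ toRaw F = r := by
  constructor
  · rintro ⟨hn, hF⟩
    obtain ⟨nb, G⟩ := r
    simp only at hn hF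
    have hlit : ∀ l : Bool × List Bool, Canonical l.2 ∧ Lt l.2 nb →
        ∃ l' : Literal (value nb), (l'.positive, encodeNat l'.var) = l := fun l hl =>
      ⟨⟨⟨value l.2, lt_iff.1 hl.2⟩, l.1⟩, by simp [encodeNat_value hl.1]⟩
    have hex : G ∈ Set.range (List.map (List.map fun l : Literal (value nb) =>
        (l.positive, encodeNat l.var))) := by
      rw [Set.range_list_map]
      intro C hC
      rw [Set.range_list_map]
      exact fun l hl => hlit l ((hF C hC).2 l hl)
    obtain ⟨F, rfl⟩ := hex
    refine ⟨value nb, F, fun C hC => ?_, Prod.ext (encodeNat_value hn) rfl⟩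
    simpa using (hF _ (List.mem_map_of_mem hC)).1
  · rintro ⟨n, F, hF, rfl⟩
    refine ⟨canonical_encodeNat n, fun C hC => ?_⟩
    obtain ⟨C, hC', rfl⟩ := List.mem_map.1 hC
    refine ⟨by simpa using hF C hC', fun l hl => ?_⟩
    obtain ⟨l, hl, rfl⟩ := List.mem_map.1 hl
    refine ⟨canonical_encodeNat _, lt_iff.2 ?_⟩
    simp only [toRaw, value_encodeNat]
    exact l.var.isLt

/-- The formula as a list of lists of pairs. -/
def toFormula {n : ℕ} (F : CNF n) : Formula (Fin n) :=
  F.map (List.map fun l => (l.positive, l.var))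

theorem toRaw_snd {n : ℕ} (F : CNF n) :
    (toRaw F).2 = rename (fun i : Fin n => encodeNat i) (toFormula F) := by
  simp [toRaw, toFormula, rename, renameLit, Function.comp_def]

theorem encodeNat_injective : Function.Injective encodeNat := fun m n h => by
  rw [← value_encodeNat m, h, value_encodeNat]

theorem numSat_eq {n : ℕ} (F : CNF n) : CNF.numSat F = count (toFormula F) := by
  rw [CNF.numSat, count]
  refine congrArg Finset.card (Finset.filter_congr fun a _ => ?_)
  have hlit : ∀ l : Literal n, l.eval a = true ↔ a l.var = l.positive := by
    rintro ⟨v, b⟩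
    cases b <;> simp [Literal.eval]
  simp only [CNF.eval, Clause.eval, Sat, toFormula, hlit, List.all_eq_true, List.any_eq_true,
    List.mem_map, forall_exists_index, and_imp, forall_apply_eq_imp_iff₂, exists_exists_and_eq_and]

/-- Remove the clauses with complementary literals. -/
def dropTaut {ν : Type} [DecidableEq ν] (F : Formula ν) : Formula ν :=
  F.filter fun C => decide (∀ l ∈ C, neg l ∉ C)

theorem nontaut_dropTaut {ν : Type} [DecidableEq ν] (F : Formula ν) : Nontaut (dropTaut F) :=
  fun _ hC => by simpa using (List.mem_filter.1 hC).2

theorem count_dropTaut {ν : Type} [DecidableEq ν] [Fintype ν] (F : Formula ν) :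
    count (dropTaut F) = count F := by
  refine congrArg Finset.card (Finset.filter_congr fun a _ => ⟨fun h C hC => ?_, fun h C hC =>
    h C (List.mem_of_mem_filter hC)⟩)
  by_cases hn : ∀ l ∈ C, neg l ∉ C
  · exact h C (List.mem_filter.2 ⟨hC, by simpa using hn⟩)
  · push Not at hn
    obtain ⟨l, hl, hl'⟩ := hn
    by_cases hal : a l.2 = l.1
    · exact ⟨l, hl, hal⟩
    · refine ⟨_, hl', ?_⟩
      simpa [neg, Bool.eq_not] using hal

theorem dropTaut_rename {ν μ : Type} [DecidableEq ν] [DecidableEq μ] {g : ν → μ}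
    (hg : Function.Injective g) (F : Formula ν) :
    dropTaut (rename g F) = rename g (dropTaut F) := by
  simp only [dropTaut, rename, List.filter_map, Function.comp_def, List.forall_mem_map,
    neg_renameLit, List.mem_map_of_injective (renameLit_injective hg)]

end StackProg

/-! ### The decision procedure. -/

open StackProg LitCNF in
theorem theorem4 (k : ℕ) (hk : k ≤ 3) : InP (GtMajorityKSAT k) := by
  obtain ⟨C, hC⟩ := exists_depth
  refine inP_of_polyDec ?_
  have h1 : PolyDec fun w : List Γ' => encodeRaw (parse w) = w :=
    PolyDec.eq (Poly.encodeRaw.comp Poly.parse) Poly.id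
  have h2 := (PolyDec.validRaw k).comp Poly.parse
  have h3 : PolyDec fun w : List Γ' => val C (dropTaut (parse w).2) ≤ 2 ^ C / 2 :=
    (PolyDec.val_le C (2 ^ C / 2)).comp (Poly.filterNontaut.comp Poly.parse.snd)
  refine (h1.and (h2.and h3.not)).congr fun w => ?_
  -- The number `n` drops out of the criterion, because `val` depends only on the clauses.
  -- Tautologies are removed as `exists_depth` requires, without changing the count.
  have key : ∀ (n : ℕ) (F : CNF n), CNF.IsKCNF k F →
      (2 ^ n < 2 * CNF.numSat F ↔ ¬val C (dropTaut (toRaw F).2) ≤ 2 ^ C / 2) := by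
    intro n F hF
    have hinj : Function.Injective fun i : Fin n => encodeNat i :=
      encodeNat_injective.comp Fin.val_injective
    have hw : Width 3 (dropTaut (toFormula F)) := by
      intro D hD
      obtain ⟨D', hD', rfl⟩ := List.mem_map.1 (List.mem_of_mem_filter hD)
      rw [List.length_map]
      exact (hF D' hD').trans hk
    have := hC (Fin n) _ hw (nontaut_dropTaut _)
    rw [count_dropTaut, Fintype.card_fin, ← numSat_eq] at this
    rw [toRaw_snd, dropTaut_rename hinj, val_rename hinj, Nat.le_div_iff_mul_le two_pos,
      mul_comm (val _ _), ← this, not_le]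
  constructor
  · rintro ⟨n, F, hF, hlt, rfl⟩
    rw [← encodeRaw_toRaw, parse_encodeRaw]
    exact ⟨rfl, validRaw_iff.2 ⟨n, F, hF, rfl⟩, (key n F hF).1 hlt⟩
  · rintro ⟨hw, hv, hval⟩
    obtain ⟨n, F, hF, hr⟩ := validRaw_iff.1 hv
    rw [← hr] at hval hw
    exact ⟨n, F, hF, (key n F hF).2 hval, by rw [← encodeRaw_toRaw, hw]⟩
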